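/- Let $\mathcal F$ be the Fock space of the Ramond fermion: it is generated by a vector $|0\rangle$ over operators $\phi_n$ ($n\in\mathbb Z$) with $\phi_m\phi_n+\phi_n\phi_m=\delta_{m,-n}$ and $\phi_n|0\rangle=0$ for $n>0$, and it has the basis $\phi_\lambda=\phi_{-\lambda_1}\cdots\phi_{-\lambda_\ell}|0\rangle$, $\phi_\lambda\phi_0=\phi_{-\lambda_1}\cdots\phi_{-\lambda_\ell}\phi_0|0\rangle$, where $\lambda=(\lambda_1>\cdots>\lambda_\ell>0)$ runs over all strict partitions. Let $L_0$ multiply $\phi_\lambda$ and $\phi_\lambda\phi_0$ by $|\lambda|$, and let $\mathcal F_0\subset\mathcal F$ be spanned by the $\phi_\lambda$ with $\ell(\lambda)$ even and the $\phi_\lambda\phi_0$ with $\ell(\lambda)$ odd. Put $$\mathcal B_0(t)=\sum_{k>0}(t^k-t^{-k})\,\phi_{-k}\phi_k+\frac{t+1}{2(t-1)}\,I .$$ Let $q\in\mathbb C$ with $0<|q|<1$. For $n\ge 0$ let $C_n$ be the set of $t\in(\mathbb C\setminus\{0,1\})^n$ with $|q|\prod_{i}\max(|t_i|,|t_i|^{-1})<1$,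 and let $U_n$ be the set of $t\in(\mathbb C\setminus\{0,1\})^n$ such that $\prod_i t_i^{e_i}\ne q^r$ for all $e\in\{-1,0,1\}^n$ and all $r\in\mathbb Z\setminus\{0\}$. The $n$-point function is $$R(t_1,\dots,t_n)=\mathrm{Tr}|_{\mathcal F_0}\,q^{L_0}\mathcal B_0(t_1)\cdots\mathcal B_0(t_n).$$ (a) For $t\in C_n$ this trace, the sum of the diagonal entries in the above basis of $\mathcal F_0$, converges absolutely. (b) For every $n\ge1$ the function $R$ satisfies the $q$-difference equation $$R(qt_1,t_2,\dots,t_n)=\sum_{s=0}^{n-1}\ \sum_{1<i_1<\cdots<i_s\le n}\ \sum_{\varepsilon_{i_a}=\pm1}(-1)^{1+s+\#\varepsilon}\,R\bigl(t_1t_{i_1}^{\varepsilon_{i_1}}\cdots t_{i_s}^{\varepsilon_{i_s}},\dots,\widehat{t}_{i_1},\dots,\widehat{t}_{i_s},\dots\bigr),$$ where $\#\varepsilon$ is the number of $-1$'s among $\varepsilon_{i_1},\dots,\varepsilon_{i_s}$ and $\widehat t_i$ means that this variable is removed from the list $t_2,\dots,t_n$. It holds between convergent traces at every $(t_1,\dots,t_n)$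 for which the arguments of all the terms lie in the corresponding sets $C_m$. (c) For every $n\ge0$ the function $R$ has a unique analytic continuation from $C_n$ to $U_n$, i.e. there is exactly one holomorphic function on $U_n$ that agrees with $R$ on $C_n$. The continued functions satisfy the equation in (b) at every $(t_1,\dots,t_n)$ for which the arguments of all the terms lie in the corresponding sets $U_m$. -/

import Mathlib

open Finset

noncomputable section

namespace TwistedFock

/-- The Fock space `𝓕` of Ramond type, given through its standard basis. A basis vector is a finite
set `A` of natural numbers; if `λ₁ > ⋯ > λ_ℓ > 0` are the nonzero elements of `A` (a strict
partition), it stands for `φ_{-λ₁} ⋯ φ_{-λ_ℓ} |0⟩` when `0 ∉ A` and for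
`φ_{-λ₁} ⋯ φ_{-λ_ℓ} φ_0 |0⟩` when `0 ∈ A`. -/
abbrev Fock : Type := Finset ℕ →₀ ℂ

/-- The basis vector attached to `A`. -/
def vec (A : Finset ℕ) : Fock := Finsupp.single A 1

/-- The highest weight vector `|0⟩`. -/
def vacuum : Fock := vec ∅

/-- The linear operator with prescribed values on the basis vectors. -/
def ofBasis (f : Finset ℕ → Fock) : Module.End ℂ Fock := Finsupp.linearCombination ℂ f

@[simp] theorem ofBasis_vec (f : Finset ℕ → Fock) (A : Finset ℕ) : ofBasis f (vec A) = f A := by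
  simp [ofBasis, vec]

theorem ext_vec {S T : Module.End ℂ Fock} (h : ∀ A, S (vec A) = T (vec A)) : S = T :=
  Finsupp.lhom_ext' fun A => LinearMap.ext_ring (h A)

/-- The sign produced by moving a mode `k` to its place in the decreasing product attached
to `A`. -/
def sgn (k : ℕ) (A : Finset ℕ) : ℂ := (-1) ^ (A.filter (k < ·)).card

/-- Insertion of the mode `k`. -/
def create (k : ℕ) : Module.End ℂ Fock :=
  ofBasis fun A => if k ∈ A then 0 else sgn k A • vec (insert k A)

/-- Removal of the mode `k`. -/
def annih (k : ℕ) : Module.End ℂ Fock :=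
  ofBasis fun A => if k ∈ A then sgn k A • vec (A.erase k) else 0

/-- The modes `φ_n`, `n ∈ ℤ`, of the fermionic field of Ramond type. -/
def phi (n : ℤ) : Module.End ℂ Fock :=
  if n < 0 then create n.natAbs
  else if 0 < n then annih n.natAbs
  else create 0 + (1 / 2 : ℂ) • annih 0

/-- The normal ordered product `:φ_{-i} φ_j:`, i.e. the action of `E_{i,j} - E_{-j,-i}`. -/
def normalOrdered (i j : ℤ) : Module.End ℂ Fock :=
  if i = j ∧ j < 0 then phi (-i) * phi j - 1 else phi (-i) * phi j

/-- The operator `𝓑₀(t) = ∑_{k > 0} (t^k - t^{-k}) (E_{k,k} - E_{-k,-k}) + (t+1)/(2(t-1)) I`. On each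
basis vector only finitely many terms of the sum are nonzero. -/
def opB (t : ℂ) : Module.End ℂ Fock :=
  ofBasis (fun A => ∑ᶠ k : ℕ+,
    (t ^ (k : ℤ) - t ^ (-(k : ℤ))) • normalOrdered (k : ℤ) (k : ℤ) (vec A))
  + ((t + 1) / (2 * (t - 1))) • 1

/-- The operator `q^{L₀}`, where `L₀` multiplies the basis vector of `A` by `|λ| = ∑_{a ∈ A} a`. -/
def qL0 (q : ℂ) : Module.End ℂ Fock := ofBasis fun A => q ^ (∑ a ∈ A, a) • vec A

/-- The index set of the standard basis of the subspace `𝓕₀`: the vectors `φ_λ` with `ℓ(λ)` even and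
`φ_λ φ_0` with `ℓ(λ)` odd, that is, the sets `A` with an even number of elements. -/
abbrev EvenIndex : Type := {A : Finset ℕ // Even A.card}

/-- The diagonal matrix entries on `𝓕₀` of an operator. -/
def diagEntry (T : Module.End ℂ Fock) (A : EvenIndex) : ℂ := T (vec A.1) A.1

/-- The trace over `𝓕₀`. -/
def traceF0 (T : Module.End ℂ Fock) : ℂ := ∑' A : EvenIndex, diagEntry T A

/-- The operator `q^{L₀} 𝓑₀(t₁) ⋯ 𝓑₀(t_n)`. -/
def nPointOp (q : ℂ) {n : ℕ} (t : Fin n → ℂ) : Module.End ℂ Fock :=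
  qL0 q * (List.ofFn fun i => opB (t i)).prod

/-- The `n`-point function `R(t₁, …, t_n) = Tr_{𝓕₀} q^{L₀} 𝓑₀(t₁) ⋯ 𝓑₀(t_n)`. -/
def R (q : ℂ) (n : ℕ) (t : Fin n → ℂ) : ℂ := traceF0 (nPointOp q t)

/-- The region on which the trace defining `R` is an absolutely convergent series. -/
def convDomain (q : ℂ) (n : ℕ) : Set (Fin n → ℂ) :=
  {t | (∀ i, t i ≠ 0 ∧ t i ≠ 1) ∧ ‖q‖ * ∏ i, max ‖t i‖ ‖t i‖⁻¹ < 1}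

/-- The points of `(ℂ \ {0})^n` that lie on none of the hypersurfaces `t_i = 1` and
`∏ t_i^{ε_i} = q^r` with `ε_i ∈ {-1, 0, 1}`, `r ∈ ℤ \ {0}`. -/
def regDomain (q : ℂ) (n : ℕ) : Set (Fin n → ℂ) :=
  {t | (∀ i, t i ≠ 0 ∧ t i ≠ 1) ∧
    ∀ (e : Fin n → SignType) (r : ℤ), r ≠ 0 → ∏ i, t i ^ (e i : ℤ) ≠ q ^ r}

/-- The arguments `(x t_{i₁}^{ε₁} ⋯ t_{i_s}^{ε_s}, …, t̂_{i₁}, …, t̂_{i_s}, …)`: the variables `t_i`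
with `i ∈ S = {i₁ < ⋯ < i_s}` are removed, the others are kept in their order. -/
def reducedArgs {n : ℕ} (x : ℂ) (t : Fin n → ℂ) (S : Finset (Fin n)) (ε : S → ℤˣ) :
    Fin (Sᶜ.card + 1) → ℂ :=
  Fin.cons (x * ∏ i : S, t i ^ ((ε i : ℤˣ) : ℤ)) fun j => t (Sᶜ.orderEmbOfFin rfl j)

/-! The operators satisfy the relations `[φ_m, φ_n]₊ = δ_{m,-n}`, and the basis vectors are the
stated products applied to `|0⟩`. -/

theorem sgn_mul_self (k : ℕ) (A : Finset ℕ) : sgn k A * sgn k A = 1 := by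
  rw [sgn, ← mul_pow]; simp

theorem sgn_insert {j k : ℕ} {A : Finset ℕ} (h : k ∉ A) :
    sgn j (insert k A) = (if j < k then -1 else 1) * sgn j A := by
  unfold sgn
  rw [Finset.filter_insert]
  split_ifs with hjk
  · rw [Finset.card_insert_of_notMem (by simp [h]), pow_succ]; ring
  · simp

theorem sgn_erase {j k : ℕ} {A : Finset ℕ} (h : k ∈ A) :
    sgn j (A.erase k) = (if j < k then -1 else 1) * sgn j A := by
  have := sgn_insert (j := j) (Finset.notMem_erase k A)
  rw [Finset.insert_erase h] at this
  rw [this]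
  split_ifs <;> ring

theorem create_create (j k : ℕ) : create j * create k + create k * create j = 0 := by
  refine ext_vec fun A => ?_
  rcases eq_or_ne j k with rfl | hjk
  · by_cases h : j ∈ A <;> simp [create, h]
  · by_cases hj : j ∈ A <;> by_cases hk : k ∈ A <;>
      simp [create, hj, hk, hjk, hjk.symm, sgn_insert, Finset.insert_comm j k, smul_smul]
    rcases lt_or_gt_of_ne hjk with h | h <;> simp [h, h.not_gt, mul_comm (sgn k A)]

theorem annih_annih (j k : ℕ) : annih j * annih k + annih k * annih j = 0 := by
  refine ext_vec fun A => ?_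
  rcases eq_or_ne j k with rfl | hjk
  · by_cases h : j ∈ A <;> simp [annih, h]
  · by_cases hj : j ∈ A <;> by_cases hk : k ∈ A <;>
      simp [annih, hj, hk, hjk, hjk.symm, sgn_erase, Finset.erase_right_comm (a := j) (b := k),
        smul_smul]
    rcases lt_or_gt_of_ne hjk with h | h <;> simp [h, h.not_gt, mul_comm (sgn k A)]

theorem annih_create (j k : ℕ) :
    annih j * create k + create k * annih j = if j = k then 1 else 0 := by
  refine ext_vec fun A => ?_
  rcases eq_or_ne j k with rfl | hjk
  · by_cases h : j ∈ A <;>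
      simp [annih, create, h, sgn_insert, sgn_erase, smul_smul, sgn_mul_self]
  · by_cases hj : j ∈ A <;> by_cases hk : k ∈ A <;>
      simp [annih, create, hj, hk, hjk, hjk.symm, sgn_insert, sgn_erase, smul_smul,
        Finset.erase_insert_of_ne hjk.symm]
    rcases lt_or_gt_of_ne hjk with h | h <;> simp [h, h.not_gt, mul_comm (sgn k A)]

theorem phi_neg {k : ℕ} (hk : 0 < k) : phi (-(k : ℤ)) = create k := by
  simp [phi, hk]

theorem phi_pos {k : ℕ} (hk : 0 < k) : phi (k : ℤ) = annih k := by
  simp [phi, hk]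

theorem phi_zero : phi 0 = create 0 + (1 / 2 : ℂ) • annih 0 := by
  simp [phi]

theorem phi_anticomm (m n : ℤ) :
    phi m * phi n + phi n * phi m = if m = -n then 1 else 0 := by
  have hcc := create_create
  have haa := annih_annih
  have hac := annih_create
  have hca : ∀ j k, create j * annih k + annih k * create j = if j = k then 1 else 0 := by
    intro j k
    rw [add_comm, hac]
    simp only [eq_comm]
  have e : ∀ (S T U V : Module.End ℂ Fock) (c : ℂ), S * (T + c • U) + (T + c • U) * S
      = (S * T + T * S) + c • (S * U + U * S) := by
    intro S T U V c
    simp only [mul_add, add_mul, mul_smul_comm, smul_mul_assoc, smul_add]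
    abel
  rcases lt_trichotomy m 0 with hm | rfl | hm <;> rcases lt_trichotomy n 0 with hn | rfl | hn
  · rw [if_neg (by omega)]
    simp only [phi, if_pos hm, if_pos hn, hcc]
  · rw [if_neg (by omega), phi_zero, e _ _ _ 0]
    simp only [phi, if_pos hm, hcc, hca]
    rw [if_neg (by omega)]; simp
  · simp only [phi, if_pos hm, if_pos hn, if_neg hn.not_gt, hca]
    congr 1
    exact propext (by omega)
  · rw [if_neg (by omega), phi_zero, add_comm, e _ _ _ 0]
    simp only [phi, if_pos hn, hcc, hca]
    rw [if_neg (by omega)]; simp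
  · have h0 := hcc 0 0
    have h1 := haa 0 0
    have h2 := hac 0 0
    rw [← two_nsmul, smul_eq_zero] at h0 h1
    replace h0 := h0.resolve_left (by norm_num)
    replace h1 := h1.resolve_left (by norm_num)
    have h3 : phi 0 * phi 0 = (1 / 2 : ℂ) • (1 : Module.End ℂ Fock) := by
      rw [if_pos rfl] at h2
      rw [phi_zero, ← h2]
      simp only [add_mul, mul_add, mul_smul_comm, smul_mul_assoc, h0, h1, smul_zero, smul_add]
      abel
    rw [h3, ← add_smul]
    norm_num
  · rw [if_neg (by omega), phi_zero, add_comm, e _ _ _ 0]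
    simp only [phi, if_pos hn, if_neg hn.not_gt, haa, hac]
    rw [if_neg (by omega)]; simp
  · simp only [phi, if_pos hm, if_pos hn, if_neg hm.not_gt, hac]
    congr 1
    exact propext (by omega)
  · rw [if_neg (by omega), phi_zero, e _ _ _ 0]
    simp only [phi, if_pos hm, if_neg hm.not_gt, haa, hac]
    rw [if_neg (by omega)]; simp
  · rw [if_neg (by omega)]
    simp only [phi, if_pos hm, if_pos hn, if_neg hm.not_gt, if_neg hn.not_gt, haa]

theorem phi_vacuum {n : ℤ} (hn : 0 < n) : phi n vacuum = 0 := by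
  simp [phi, hn, hn.not_gt, vacuum, annih]

theorem phi_zero_vacuum : phi 0 vacuum = vec {0} := by
  simp [phi_zero, vacuum, create, annih, sgn]

theorem phi_vec {k : ℕ} (hk : 0 < k) {A : Finset ℕ} (hA : ∀ a ∈ A, a < k) :
    phi (-(k : ℤ)) (vec A) = vec (insert k A) := by
  have h1 : k ∉ A := fun h => lt_irrefl _ (hA k h)
  have h2 : A.filter (k < ·) = ∅ := Finset.filter_eq_empty_iff.2 fun a ha => (hA a ha).not_gt
  simp [phi_neg hk, create, h1, sgn, h2]

/-- The sum over `k` in the definition of `opB` is finite on each basis vector. -/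
theorem normalOrdered_vec (k : ℕ+) (A : Finset ℕ) :
    normalOrdered (k : ℤ) (k : ℤ) (vec A) = if (k : ℕ) ∈ A then vec A else 0 := by
  have hk : 0 < (k : ℕ) := k.pos
  have h : normalOrdered (k : ℤ) (k : ℤ) = create k * annih k := by
    have h1 := phi_neg hk
    have h2 := phi_pos hk
    rw [normalOrdered, if_neg (by omega), h1, h2]
  rw [h]
  by_cases hA : (k : ℕ) ∈ A <;> simp [create, annih, hA, sgn_erase, smul_smul, sgn_mul_self]

end TwistedFock

end

/-! Each `opB t` is diagonal in the standard basis, so the trace is the sum over even sets `A` of `q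
^ ∑ a` times the product of the eigenvalues `eig A (t i)`. With `N` the sum of the elements of `A`,
this term is at most a polynomial in `N` times `(|q| ∏ size (t i)) ^ N`, and `∑_A r ^ N` converges
for `r < 1`; this gives (a).

The engine is one bijection: toggling a mode `k > 0` together with the mode `0` preserves parity,
changes the weight by `q ^ k` and each eigenvalue by `dif k (t i)`. Hence the partial traces
`corrIn` over the sets containing `k` satisfy `shift_z corrIn = q ^ k * shift_{z+1} (corr - corrIn)`
(`shift_corrIn`). Expanding the eigenvalue of one variable `y` gives `corrCons = central y * corr +
∑_{k>0} dif k y * corrIn` (`hasSum_dif_mul_corrIn`).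

For (b), summing over signs turns the right-hand side at level `k` into `shift (-1)` and `shift 1`
of `corrIn`; the relation at `z = -1` and `z = 0` turns these into the left-hand side plus geometric
terms, which sum over `k` to the central terms (`sum_signs_dif_mul_corrIn`, `corrCons_mul`).

For (c), iterating the relation solves for `corrIn` in terms of `corr` (`corrIn_eq`). Summing over
`k` then expresses the function of `n + 1` variables through functions of at most `n` variables,
with coefficients built from the meromorphic kernels `ker` (`corrCons_eq`); their poles lie off
`regDomain`, so induction continues `R`. Uniqueness and the continued equation follow from the
identity theorem, the domains being connected because they contain all but countably many points of
the complex exponential curves starting in them (`IsCocountable.isPreconnected`). -/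

noncomputable section

namespace TwistedFock

open Filter Topology

section

/-! ### Eigenvalues and the diagonal entries -/

/-- The coefficient `t^k - t^{-k}`. -/
def dif (k : ℕ) (t : ℂ) : ℂ := t ^ (k : ℤ) - t ^ (-(k : ℤ))

/-- The central term `(t+1)/(2(t-1))`. -/
def central (t : ℂ) : ℂ := (t + 1) / (2 * (t - 1))

/-- The eigenvalue of `𝓑₀(t)` on the basis vector attached to `A`. -/
def eig (A : Finset ℕ) (t : ℂ) : ℂ := ∑ k ∈ A, dif k t + central t

@[simp] theorem dif_zero (t : ℂ) : dif 0 t = 0 := by simp [dif]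

theorem opB_vec (t : ℂ) (A : Finset ℕ) : opB t (vec A) = eig A t • vec A := by
  have h : (∑ᶠ k : ℕ+, (t ^ (k : ℤ) - t ^ (-(k : ℤ))) • normalOrdered (k : ℤ) (k : ℤ) (vec A))
      = (∑ k ∈ A, dif k t) • vec A := by
    have h1 : (fun k : ℕ+ => (t ^ (k : ℤ) - t ^ (-(k : ℤ))) • normalOrdered (k : ℤ) (k : ℤ) (vec A))
        = fun k : ℕ+ => if (k : ℕ) ∈ A then dif k t • vec A else 0 := by
      funext k
      rw [normalOrdered_vec]
      split_ifs <;> simp [dif]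
    rw [h1, finsum_eq_sum_of_support_subset (s := A.preimage ((↑) : ℕ+ → ℕ)
      PNat.coe_injective.injOn), Finset.sum_smul,
      ← Finset.sum_subset (Finset.filter_subset (0 < ·) A)]
    · refine Finset.sum_bij (fun k _ => (k : ℕ)) (fun k hk => ?_)
        (fun a _ b _ hab => PNat.coe_injective hab) (fun k hk => ?_) (fun k hk => ?_)
      · simpa using hk
      · rw [Finset.mem_filter] at hk
        exact ⟨⟨k, hk.2⟩, Finset.mem_preimage.2 hk.1, rfl⟩
      · rw [if_pos (by simpa using hk)]
    · intro k hk hk'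
      have : k = 0 := by simp [hk] at hk'; exact hk'
      simp [this]
    · intro k hk
      rw [Function.mem_support] at hk
      have : (k : ℕ) ∈ A := by
        by_contra hh
        simp [hh] at hk
      simpa using this
  rw [opB, LinearMap.add_apply, ofBasis_vec, h, eig, add_smul]
  rfl

theorem prod_opB_vec (l : List ℂ) (A : Finset ℕ) :
    (l.map opB).prod (vec A) = (l.map (eig A)).prod • vec A := by
  induction l with
  | nil => simp
  | cons a l ih =>
    simp only [List.map_cons, List.prod_cons, Module.End.mul_apply, ih, map_smul, opB_vec,
      smul_smul, mul_comm]

theorem diagEntry_nPointOp (q : ℂ) {n : ℕ} (t : Fin n → ℂ) (A : EvenIndex) :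
    diagEntry (nPointOp q t) A = q ^ (∑ a ∈ A.1, a) * ∏ i, eig A.1 (t i) := by
  have h : (List.ofFn fun i => opB (t i)) = (List.ofFn t).map opB := by
    rw [List.map_ofFn]; rfl
  rw [diagEntry, nPointOp, Module.End.mul_apply, h, prod_opB_vec, map_smul, qL0, ofBasis_vec,
    List.map_ofFn, List.prod_ofFn]
  simp [vec, mul_comm]

/-! ### Absolute convergence -/

/-- The size `max(|t|, |t|⁻¹)`. -/
def size (t : ℂ) : ℝ := max ‖t‖ ‖t‖⁻¹

theorem size_pos {t : ℂ} (ht : t ≠ 0) : 0 < size t :=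
  lt_max_of_lt_left (norm_pos_iff.2 ht)

theorem one_le_size {t : ℂ} (ht : t ≠ 0) : 1 ≤ size t := by
  have h := norm_pos_iff.2 ht
  rcases le_total 1 ‖t‖ with h1 | h1
  · exact le_max_of_le_left h1
  · exact le_max_of_le_right ((one_le_inv₀ h).2 h1)

theorem norm_zpow_le_size (t : ℂ) (k : ℕ) :
    ‖t ^ (k : ℤ)‖ ≤ size t ^ k ∧ ‖t ^ (-(k : ℤ))‖ ≤ size t ^ k := by
  constructor
  · rw [norm_zpow, zpow_natCast]
    exact pow_le_pow_left₀ (norm_nonneg t) (le_max_left _ _) k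
  · rw [norm_zpow, zpow_neg, zpow_natCast, ← inv_pow]
    exact pow_le_pow_left₀ (inv_nonneg.2 (norm_nonneg t)) (le_max_right _ _) k

theorem norm_dif_le (k : ℕ) (t : ℂ) : ‖dif k t‖ ≤ 2 * size t ^ k :=
  (norm_sub_le _ _).trans (by linarith [(norm_zpow_le_size t k).1, (norm_zpow_le_size t k).2])

/-- Every element of `A` is at most the total `N`, so there are at most `N + 1` summands, each
bounded by `2 * size t ^ N`. -/
theorem sum_norm_dif_le {t : ℂ} (ht : t ≠ 0) (A : Finset ℕ) (c : ℝ) (hc : 0 ≤ c) :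
    ∑ k ∈ A, ‖dif k t‖ + c ≤ (2 + c) * (((∑ a ∈ A, a : ℕ) : ℝ) + 1) * size t ^ (∑ a ∈ A, a) := by
  set N := ∑ a ∈ A, a with hN
  have h1 := one_le_size ht
  have hsub : A ⊆ range (N + 1) := fun k hk =>
    mem_range.2 (Nat.lt_succ_of_le (single_le_sum (f := fun a => a) (fun _ _ => Nat.zero_le _) hk))
  have h2 : ∑ k ∈ A, ‖dif k t‖ ≤ ∑ _k ∈ range (N + 1), 2 * size t ^ N :=
    (sum_le_sum_of_subset_of_nonneg hsub fun _ _ _ => norm_nonneg _).trans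
      (sum_le_sum fun k hk => (norm_dif_le k t).trans
        (mul_le_mul_of_nonneg_left
          (pow_le_pow_right₀ h1 (Nat.lt_succ_iff.1 (mem_range.1 hk))) zero_le_two))
  rw [sum_const, card_range, nsmul_eq_mul] at h2
  push_cast at h2
  have h3 : c ≤ c * ((N : ℝ) + 1) * size t ^ N := by
    have : (1 : ℝ) ≤ ((N : ℝ) + 1) * size t ^ N :=
      one_le_mul_of_one_le_of_one_le (by linarith [N.cast_nonneg (α := ℝ)]) (one_le_pow₀ h1)
    rw [mul_assoc]
    exact le_mul_of_one_le_right hc this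
  linarith

/-- The sum is the expansion of the convergent product `∏ (1 + r ^ a)`. -/
theorem summable_pow_sum {r : ℝ} (h0 : 0 ≤ r) (h1 : r < 1) :
    Summable fun A : Finset ℕ => r ^ (∑ a ∈ A, a) := by
  have := summable_finsetProd_of_summable_nonneg (f := fun a : ℕ => r ^ a)
    (fun a => pow_nonneg h0 a) (summable_geometric_of_lt_one h0 h1)
  exact this.congr fun A => prod_pow_eq_pow_sum A (fun a => a) r

theorem summable_poly_mul_pow_sum {r : ℝ} (h0 : 0 < r) (h1 : r < 1) (n : ℕ) :
    Summable fun A : Finset ℕ => (((∑ a ∈ A, a : ℕ) : ℝ) + 1) ^ n * r ^ (∑ a ∈ A, a) := by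
  -- The polynomial factor is absorbed by `(r / s) ^ N`, which leaves the summable `s ^ N`. The
  -- bound `C` is used at `N + 1`, hence the division by `r / s`.
  obtain ⟨s, hs, hs1⟩ := exists_between h1
  have hs0 := h0.trans hs
  have hrs : 0 < r / s := div_pos h0 hs0
  obtain ⟨C, hC⟩ := (tendsto_pow_const_mul_const_pow_of_lt_one n hrs.le
    ((div_lt_one hs0).2 hs)).bddAbove_range
  refine Summable.of_nonneg_of_le (fun A => by positivity) (fun A => ?_)
    ((summable_pow_sum hs0.le hs1).mul_left (C / (r / s)))
  set N := ∑ a ∈ A, a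
  have h := hC ⟨N + 1, rfl⟩
  push_cast at h
  have h2 : r ^ N = (r / s) ^ N * s ^ N := by rw [div_pow]; field_simp
  rw [h2, ← mul_assoc]
  refine mul_le_mul_of_nonneg_right ?_ (pow_nonneg hs0.le N)
  rw [le_div_iff₀ hrs, mul_assoc, ← pow_succ]
  exact h

variable {ι : Type*}

theorem summable_bound {q : ℂ} (hq : q ≠ 0) {t : ι → ℂ} {T : Finset ι} (ht : ∀ i ∈ T, t i ≠ 0)
    (h : ‖q‖ * ∏ i ∈ T, size (t i) < 1) :
    Summable fun A : Finset ℕ =>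
      ‖q‖ ^ (∑ a ∈ A, a) * ∏ i ∈ T, (∑ k ∈ A, ‖dif k (t i)‖ + ‖central (t i)‖) := by
  have hpos : 0 < ‖q‖ * ∏ i ∈ T, size (t i) :=
    mul_pos (norm_pos_iff.2 hq) (prod_pos fun i hi => size_pos (ht i hi))
  refine Summable.of_nonneg_of_le (fun A => mul_nonneg (by positivity)
    (prod_nonneg fun i _ => add_nonneg (sum_nonneg fun _ _ => norm_nonneg _) (norm_nonneg _)))
    (fun A => ?_) ((summable_poly_mul_pow_sum hpos h T.card).mul_left
      (∏ i ∈ T, (2 + ‖central (t i)‖)))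
  calc _ ≤ ‖q‖ ^ (∑ a ∈ A, a) * ∏ i ∈ T, ((2 + ‖central (t i)‖) * (((∑ a ∈ A, a : ℕ) : ℝ) + 1) *
        size (t i) ^ (∑ a ∈ A, a)) := by
        refine mul_le_mul_of_nonneg_left (prod_le_prod
          (fun i _ => add_nonneg (sum_nonneg fun _ _ => norm_nonneg _) (norm_nonneg _))
          fun i hi => sum_norm_dif_le (ht i hi) A _ (norm_nonneg _)) (by positivity)
    _ = _ := by
        rw [prod_mul_distrib, prod_mul_distrib, prod_const, prod_pow, mul_pow]
        ring

/-- The contribution of the basis vector attached to `A` to the correlation function. -/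
def term (q : ℂ) (t : ι → ℂ) (T : Finset ι) (A : Finset ℕ) : ℂ :=
  q ^ (∑ a ∈ A, a) * ∏ i ∈ T, eig A (t i)

theorem norm_eig_le (A : Finset ℕ) (t : ℂ) : ‖eig A t‖ ≤ ∑ k ∈ A, ‖dif k t‖ + ‖central t‖ :=
  (norm_add_le _ _).trans (by gcongr; exact norm_sum_le _ _)

theorem norm_term_le (q : ℂ) (t : ι → ℂ) (T : Finset ι) (A : Finset ℕ) :
    ‖term q t T A‖ ≤
      ‖q‖ ^ (∑ a ∈ A, a) * ∏ i ∈ T, (∑ k ∈ A, ‖dif k (t i)‖ + ‖central (t i)‖) := by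
  rw [term, norm_mul, norm_pow, norm_prod]
  exact mul_le_mul_of_nonneg_left (prod_le_prod (fun _ _ => norm_nonneg _)
    fun i _ => norm_eig_le A (t i)) (by positivity)

/-- The convergence condition for the variables indexed by `T`. -/
def Conv (q : ℂ) (t : ι → ℂ) (T : Finset ι) : Prop :=
  (∀ i ∈ T, t i ≠ 0) ∧ ‖q‖ * ∏ i ∈ T, size (t i) < 1

theorem prod_size_le {t : ι → ℂ} {S T : Finset ι} (hS : S ⊆ T) (h : ∀ i ∈ T, t i ≠ 0) :
    ∏ i ∈ S, size (t i) ≤ ∏ i ∈ T, size (t i) :=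
  prod_le_prod_of_subset_of_one_le hS (fun i hi => (size_pos (h i (hS hi))).le)
    fun i hi _ => one_le_size (h i hi)

theorem Conv.mono {q : ℂ} {t : ι → ℂ} {S T : Finset ι} (h : Conv q t T) (hS : S ⊆ T) :
    Conv q t S :=
  ⟨fun i hi => h.1 i (hS hi), (mul_le_mul_of_nonneg_left (prod_size_le hS h.1)
    (norm_nonneg q)).trans_lt h.2⟩

theorem summable_norm_term {q : ℂ} (hq : q ≠ 0) {t : ι → ℂ} {T : Finset ι} (h : Conv q t T) :
    Summable fun A : Finset ℕ => ‖term q t T A‖ :=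
  Summable.of_nonneg_of_le (fun _ => norm_nonneg _) (fun A => norm_term_le q t T A)
    (summable_bound hq h.1 h.2)

theorem summable_term {q : ℂ} (hq : q ≠ 0) {t : ι → ℂ} {T : Finset ι} (h : Conv q t T) :
    Summable fun A : EvenIndex => term q t T A.1 :=
  (summable_norm_term hq h).of_norm.subtype _

theorem summable_term_mem {q : ℂ} (hq : q ≠ 0) {t : ι → ℂ} {T : Finset ι} (h : Conv q t T)
    (k : ℕ) : Summable fun A : EvenIndex => if k ∈ A.1 then term q t T A.1 else 0 := by
  refine Summable.of_norm_bounded ((summable_norm_term hq h).subtype {A | Even A.card})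
    fun A => ?_
  split_ifs
  · exact le_rfl
  · simp

/-- The correlation function in the variables indexed by `T`. -/
def corr (q : ℂ) (t : ι → ℂ) (T : Finset ι) : ℂ := ∑' A : EvenIndex, term q t T A.1

/-- The part of the correlation function that comes from the vectors containing the mode `k`. -/
def corrIn (q : ℂ) (t : ι → ℂ) (k : ℕ) (T : Finset ι) : ℂ :=
  ∑' A : EvenIndex, if k ∈ A.1 then term q t T A.1 else 0

end

section

/-! ### Removing a mode -/

/-- Adding or removing the mode `k > 0`, the parity being restored by the mode `0`. -/
def flip (k : ℕ) (hk : 0 < k) : EvenIndex ≃ EvenIndex :=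
  Function.Involutive.toPerm
    (fun A => ⟨symmDiff A.1 {0, k}, by
      have h0 : (0 : ℕ) ≠ k := hk.ne
      have h1 : Even ({0, k} : Finset ℕ).card := by rw [card_pair h0]; exact even_two
      have h2 := card_sdiff_add_card_inter A.1 {0, k}
      have h3 := card_sdiff_add_card_inter {0, k} A.1
      rw [inter_comm] at h3
      have h4 : (symmDiff A.1 {0, k}).card = (A.1 \ {0, k}).card + ({0, k} \ A.1).card :=
        card_union_of_disjoint disjoint_sdiff_sdiff
      have h5 := A.2
      rw [h4]
      rw [Nat.even_iff] at *
      omega⟩)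
    fun A => Subtype.ext (symmDiff_symmDiff_cancel_right _ _)

theorem mem_flip {k : ℕ} (hk : 0 < k) (A : EvenIndex) : k ∈ (flip k hk A).1 ↔ k ∉ A.1 := by
  change k ∈ symmDiff A.1 {0, k} ↔ _
  simp [mem_symmDiff]

/-- The mode `0` is invisible to weights and eigenvalues, as `f 0 = 0`; it only repairs the parity.
-/
theorem sum_flip {M : Type*} [AddCommMonoid M] {k : ℕ} (hk : 0 < k) {A : EvenIndex}
    (hA : k ∉ A.1) (f : ℕ → M) (hf : f 0 = 0) :
    ∑ a ∈ (flip k hk A).1, f a = ∑ a ∈ A.1, f a + f k := by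
  have h : ∀ B : Finset ℕ, ∑ a ∈ B, f a = ∑ a ∈ B.erase 0, f a := fun B =>
    (sum_erase B hf).symm
  rw [h, h A.1, add_comm, ← sum_insert (by simp [hA])]
  congr 1
  change (symmDiff A.1 {0, k}).erase 0 = _
  ext a
  simp only [mem_erase, mem_symmDiff, mem_insert, mem_singleton]
  by_cases h1 : a = 0
  · simp [h1, hk.ne]
  · by_cases h2 : a = k
    · simp [h2, hk.ne', hA]
    · simp [h1, h2]

variable {ι : Type*}

/-- The product `∏_{i ∈ S} (t_i^k - t_i^{-k})`. -/
def difs (k : ℕ) (t : ι → ℂ) (S : Finset ι) : ℂ := ∏ i ∈ S, dif k (t i)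

/-- The effect on a function `X` of sets of variables of adding `z (t_i^k - t_i^{-k})` to the
eigenvalues of all `𝓑₀(t_i)`. -/
def shift [DecidableEq ι] (k : ℕ) (t : ι → ℂ) (z : ℂ) (X : Finset ι → ℂ) (T : Finset ι) : ℂ :=
  ∑ S ∈ T.powerset, z ^ S.card * difs k t S * X (T \ S)

/-- A shifted term. -/
def shiftedTerm (q : ℂ) (t : ι → ℂ) (k : ℕ) (z : ℂ) (T : Finset ι) (A : Finset ℕ) : ℂ :=
  q ^ (∑ a ∈ A, a) * ∏ i ∈ T, (eig A (t i) + z * dif k (t i))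

theorem shiftedTerm_eq [DecidableEq ι] (q : ℂ) (t : ι → ℂ) (k : ℕ) (z : ℂ) (T : Finset ι) (A : Finset ℕ) :
    shiftedTerm q t k z T A = shift k t z (fun S => term q t S A) T := by
  simp only [shiftedTerm, shift, term, difs]
  simp_rw [add_comm (eig A _), prod_add, prod_mul_distrib, prod_const, mul_sum]
  exact sum_congr rfl fun S _ => by ring

theorem shift_zero [DecidableEq ι] (k : ℕ) (t : ι → ℂ) (X : Finset ι → ℂ) (T : Finset ι) :
    shift k t 0 X T = X T := by
  rw [shift, sum_eq_single ∅]
  · simp [difs]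
  · intro S _ hS
    rw [zero_pow (by simpa using hS)]; simp
  · simp

theorem hasSum_shiftedTerm [DecidableEq ι] {q : ℂ} (hq : q ≠ 0) {t : ι → ℂ} {T : Finset ι} (h : Conv q t T)
    (k : ℕ) (z : ℂ) :
    HasSum (fun A : EvenIndex => shiftedTerm q t k z T A.1) (shift k t z (corr q t) T) := by
  simp_rw [shiftedTerm_eq]
  exact hasSum_sum fun S _ => (summable_term hq (h.mono sdiff_subset)).hasSum.mul_left _

theorem hasSum_shiftedTerm_mem [DecidableEq ι] {q : ℂ} (hq : q ≠ 0) {t : ι → ℂ} {T : Finset ι} (h : Conv q t T)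
    (k : ℕ) (z : ℂ) :
    HasSum (fun A : EvenIndex => if k ∈ A.1 then shiftedTerm q t k z T A.1 else 0)
      (shift k t z (corrIn q t k) T) := by
  have : (fun A : EvenIndex => if k ∈ A.1 then shiftedTerm q t k z T A.1 else 0)
      = fun A : EvenIndex => ∑ S ∈ T.powerset, z ^ S.card * difs k t S *
        (if k ∈ A.1 then term q t (T \ S) A.1 else 0) := by
    funext A
    split_ifs
    · exact shiftedTerm_eq ..
    · simp
  rw [this]
  exact hasSum_sum fun S _ => (summable_term_mem hq (h.mono sdiff_subset) k).hasSum.mul_left _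

theorem shiftedTerm_flip (q : ℂ) (t : ι → ℂ) {k : ℕ} (hk : 0 < k) (z : ℂ) (T : Finset ι)
    {A : EvenIndex} (hA : k ∉ A.1) :
    shiftedTerm q t k z T (flip k hk A).1 = q ^ k * shiftedTerm q t k (z + 1) T A.1 := by
  simp only [shiftedTerm, eig]
  rw [sum_flip hk hA (fun a => a) rfl, pow_add, mul_comm (q ^ _) (q ^ k), mul_assoc]
  congr 2
  refine prod_congr rfl fun i _ => ?_
  rw [sum_flip hk hA _ (dif_zero _)]
  ring

/-- The effect of removing the mode `k` from the vectors that contain it. -/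
theorem shift_corrIn [DecidableEq ι] {q : ℂ} (hq : q ≠ 0) {t : ι → ℂ} {T : Finset ι} (h : Conv q t T)
    {k : ℕ} (hk : 0 < k) (z : ℂ) :
    shift k t z (corrIn q t k) T
      = q ^ k * (shift k t (z + 1) (corr q t) T - shift k t (z + 1) (corrIn q t k) T) := by
  -- Reindexing by `flip` turns the sum over sets containing `k` into one over sets avoiding `k`,
  -- that is, the full sum minus the sum over sets containing `k`.
  have h1 := (flip k hk).hasSum_iff.2 (hasSum_shiftedTerm_mem hq h k z)
  have h2 := ((hasSum_shiftedTerm hq h k (z + 1)).sub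
    (hasSum_shiftedTerm_mem hq h k (z + 1))).mul_left (q ^ k)
  refine h1.unique (h2.congr_fun ?_)
  intro A
  simp only [Function.comp_apply, mem_flip]
  by_cases hA : k ∈ A.1
  · simp [hA]
  · simp [hA, shiftedTerm_flip q t hk z T hA]

/-! ### Expanding one eigenvalue -/

/-- The correlation function in the variables indexed by `T` and one more variable `y`. -/
def corrCons (q y : ℂ) (t : ι → ℂ) (T : Finset ι) : ℂ :=
  ∑' A : EvenIndex, q ^ (∑ a ∈ A.1, a) * (eig A.1 y * ∏ i ∈ T, eig A.1 (t i))

/-- The double series over pairs `k ∈ A` converges absolutely, so it may be summed over `A` first or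
over `k` first. -/
theorem hasSum_dif_mul_corrIn {q : ℂ} (hq : q ≠ 0) {t : ι → ℂ} {T : Finset ι} {y : ℂ}
    (hy : y ≠ 0) (ht : ∀ i ∈ T, t i ≠ 0) (h : ‖q‖ * (size y * ∏ i ∈ T, size (t i)) < 1) :
    HasSum (fun k : ℕ => dif (k + 1) y * corrIn q t (k + 1) T)
      (corrCons q y t T - central y * corr q t T) := by
  have hT : Conv q t T := ⟨ht, lt_of_le_of_lt (mul_le_mul_of_nonneg_left
    (le_mul_of_one_le_left (prod_nonneg fun i hi => (size_pos (ht i hi)).le) (one_le_size hy))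
    (norm_nonneg q)) h⟩
  -- Treating `y` as one more variable makes the earlier bound dominate the double series.
  let u : Option ι → ℂ := fun o => o.elim y t
  have hu : Conv q u T.insertNone := by
    refine ⟨?_, by simpa [u] using h⟩
    rintro (_ | i) hi
    · exact hy
    · exact ht i (by simpa using hi)
  have hb := (summable_bound hq hu.1 hu.2).subtype {A | Even A.card}
  have hF : Summable fun p : EvenIndex × ℕ =>
      if p.2 ∈ p.1.1 then dif p.2 y * term q t T p.1.1 else 0 := by
    refine Summable.of_norm ((summable_prod_of_nonneg fun _ => norm_nonneg _).2
      ⟨fun A => summable_of_ne_finset_zero (s := A.1) fun k hk => by simp [hk], ?_⟩)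
    refine Summable.of_nonneg_of_le (fun _ => tsum_nonneg fun _ => norm_nonneg _) (fun A => ?_) hb
    rw [tsum_eq_sum (s := A.1) fun k hk => by simp [hk]]
    have hA : ∑ k ∈ A.1, ‖if k ∈ A.1 then dif k y * term q t T A.1 else 0‖
        = (∑ k ∈ A.1, ‖dif k y‖) * ‖term q t T A.1‖ := by
      rw [sum_mul]
      exact sum_congr rfl fun k hk => by rw [if_pos hk, norm_mul]
    refine hA.trans_le ?_
    simp only [Function.comp_apply, prod_insertNone, u, Option.elim]
    rw [mul_left_comm]
    exact mul_le_mul (le_add_of_nonneg_right (norm_nonneg _)) (norm_term_le q t T A.1)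
      (norm_nonneg _) (add_nonneg (sum_nonneg fun _ _ => norm_nonneg _) (norm_nonneg _))
  have h1 : HasSum (fun A : EvenIndex => (∑ k ∈ A.1, dif k y) * term q t T A.1)
      (∑' p : EvenIndex × ℕ, if p.2 ∈ p.1.1 then dif p.2 y * term q t T p.1.1 else 0) := by
    refine hF.hasSum.prod_fiberwise fun A => ?_
    rw [sum_mul]
    rw [← sum_congr rfl fun k hk => if_pos hk]
    exact hasSum_sum_of_ne_finset_zero fun k hk => by simp [hk]
  have h2 : HasSum (fun k : ℕ => dif k y * corrIn q t k T)
      (∑' p : EvenIndex × ℕ, if p.2 ∈ p.1.1 then dif p.2 y * term q t T p.1.1 else 0) := by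
    refine HasSum.prod_fiberwise ((Equiv.prodComm _ _).hasSum_iff.2 hF.hasSum) fun k => ?_
    refine ((summable_term_mem hq hT k).hasSum.mul_left (dif k y)).congr_fun fun A => ?_
    simp
  have h3 := h1.add ((summable_term hq hT).hasSum.mul_left (central y))
  have h4 : corrCons q y t T = _ := ((h3.congr_fun fun A => by simp only [eig, term]; ring)).tsum_eq
  rw [h4, ← corr, add_sub_cancel_right]
  -- The mode `0` drops out because `dif 0 y = 0`.
  have h5 := (hasSum_nat_add_iff' 1).2 h2
  simpa using h5

end

section

/-! ### Sums over signs -/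

variable {ι : Type*}

/-- The number of signs `-1`. -/
def negs {S : Finset ι} (ε : S → ℤˣ) : ℕ := (univ.filter fun i => ε i = -1).card

/-- The monomial `∏ t_i^{ε_i}`. -/
def mon (t : ι → ℂ) {S : Finset ι} (ε : S → ℤˣ) : ℂ := ∏ i : S, t i ^ ((ε i : ℤˣ) : ℤ)

theorem sum_signs_zpow [DecidableEq ι] (t : ι → ℂ) (S : Finset ι) (m : ℤ) :
    ∑ ε : S → ℤˣ, (-1 : ℂ) ^ negs ε * mon t ε ^ m = ∏ i ∈ S, (t i ^ m - t i ^ (-m)) := by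
  have h : ∀ i : S, t i ^ m - t i ^ (-m)
      = ∑ e : ℤˣ, (if e = -1 then (-1 : ℂ) else 1) * (t i ^ (e : ℤ)) ^ m := by
    intro i
    rw [UnitsInt.univ, sum_pair (by decide)]
    simp [sub_eq_add_neg]
  rw [← prod_coe_sort, prod_congr rfl fun i _ => h i, prod_univ_sum, Fintype.piFinset_univ]
  refine sum_congr rfl fun ε _ => ?_
  rw [prod_mul_distrib, prod_ite, prod_const, prod_const_one, mul_one, mon, negs, prod_zpow]

theorem sum_signs_pow [DecidableEq ι] (t : ι → ℂ) (S : Finset ι) (k : ℕ) :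
    ∑ ε : S → ℤˣ, (-1 : ℂ) ^ negs ε * mon t ε ^ (k : ℤ) = difs k t S :=
  sum_signs_zpow t S k

theorem sum_signs_inv_pow [DecidableEq ι] (t : ι → ℂ) (S : Finset ι) (k : ℕ) :
    ∑ ε : S → ℤˣ, (-1 : ℂ) ^ negs ε * mon t ε ^ (-(k : ℤ)) = (-1) ^ S.card * difs k t S := by
  rw [sum_signs_zpow, difs, ← prod_const, ← prod_mul_distrib]
  exact prod_congr rfl fun i _ => by rw [dif, neg_neg]; ring

/-- The exponent `0` makes every factor of the sign product vanish. This disposes of the constants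
`1 / 2` left by the geometric series. -/
theorem sum_signs [DecidableEq ι] (S : Finset ι) :
    ∑ ε : S → ℤˣ, (-1 : ℂ) ^ negs ε = if S = ∅ then 1 else 0 := by
  have := sum_signs_zpow (fun _ : ι => (1 : ℂ)) S 0
  simp only [zpow_zero, mul_one, neg_zero, sub_self, prod_const] at this
  rw [this]
  split_ifs with h
  · simp [h]
  · exact zero_pow (by simpa using h)

theorem size_inv_le_norm_zpow_unit {t : ℂ} (ht : t ≠ 0) (e : ℤˣ) :
    (size t)⁻¹ ≤ ‖t ^ (e : ℤ)‖ ∧ ‖t ^ (e : ℤ)‖ ≤ size t := by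
  have h := norm_pos_iff.2 ht
  have h1 : ‖t‖ ≤ size t := le_max_left _ _
  have h2 : ‖t‖⁻¹ ≤ size t := le_max_right _ _
  have h3 := size_pos ht
  rcases Int.units_eq_one_or e with rfl | rfl
  · simp only [Units.val_one, zpow_one]
    exact ⟨by rw [inv_le_comm₀ h3 h]; exact h2, h1⟩
  · simp only [Units.val_neg, Units.val_one, zpow_neg, zpow_one, norm_inv]
    exact ⟨by rw [inv_le_inv₀ h3 h]; exact h1, h2⟩

theorem norm_mon_le {t : ι → ℂ} {S : Finset ι} (ht : ∀ i ∈ S, t i ≠ 0) (ε : S → ℤˣ) :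
    (∏ i ∈ S, size (t i))⁻¹ ≤ ‖mon t ε‖ ∧ ‖mon t ε‖ ≤ ∏ i ∈ S, size (t i) := by
  rw [mon, norm_prod, ← prod_coe_sort, ← prod_inv_distrib]
  exact ⟨prod_le_prod (fun i _ => inv_nonneg.2 (size_pos (ht i i.2)).le)
      fun i _ => (size_inv_le_norm_zpow_unit (ht i i.2) _).1,
    prod_le_prod (fun i _ => norm_nonneg _)
      fun i _ => (size_inv_le_norm_zpow_unit (ht i i.2) _).2⟩

theorem mon_ne_zero {t : ι → ℂ} {S : Finset ι} (ht : ∀ i ∈ S, t i ≠ 0) (ε : S → ℤˣ) :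
    mon t ε ≠ 0 :=
  prod_ne_zero_iff.2 fun i _ => zpow_ne_zero _ (ht i i.2)

/-! ### The difference equation between convergent traces -/

theorem hasSum_pow_succ {y : ℂ} (hy : ‖y‖ < 1) :
    HasSum (fun k : ℕ => y ^ ((k + 1 : ℕ) : ℤ)) (-central y - 1 / 2) := by
  have h1 : y ≠ 1 := by rintro rfl; simp at hy
  have h2 : 1 - y ≠ 0 := sub_ne_zero.2 h1.symm
  have h3 : y - 1 ≠ 0 := sub_ne_zero.2 h1
  have h := (hasSum_geometric_of_norm_lt_one hy).mul_left y
  have e : -central y - 1 / 2 = y * (1 - y)⁻¹ := by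
    rw [central]; field_simp; ring
  rw [e]
  exact h.congr_fun fun k => by rw [zpow_natCast, pow_succ']

theorem hasSum_inv_pow_succ {y : ℂ} (hy : 1 < ‖y‖) :
    HasSum (fun k : ℕ => y ^ (-((k + 1 : ℕ) : ℤ))) (central y - 1 / 2) := by
  have h0 : y ≠ 0 := by rintro rfl; simp at hy; linarith
  have h1 : y ≠ 1 := by rintro rfl; simp at hy
  have h3 : y - 1 ≠ 0 := sub_ne_zero.2 h1
  have h4 : 1 - y ≠ 0 := sub_ne_zero.2 h1.symm
  have h := hasSum_pow_succ (y := y⁻¹) (by rw [norm_inv]; exact inv_lt_one_of_one_lt₀ hy)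
  have h5 : y⁻¹ - 1 ≠ 0 := by
    intro h; apply h1; rw [sub_eq_zero, inv_eq_one] at h; exact h
  have e : -central y⁻¹ - 1 / 2 = central y - 1 / 2 := by
    rw [central, central]; field_simp; ring
  rw [e] at h
  exact h.congr_fun fun k => by rw [zpow_neg, inv_zpow]

variable [Fintype ι] [DecidableEq ι]

theorem shift_univ (k : ℕ) (t : ι → ℂ) (z : ℂ) (X : Finset ι → ℂ) :
    shift k t z X univ = ∑ S : Finset ι, z ^ S.card * difs k t S * X Sᶜ := by
  rw [shift, powerset_univ]
  rfl

/-- Positive powers of `x * mon t ε` assemble to `shift (-1)` of `corrIn`, negative ones to `shift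
1`, since inverting all signs costs `(-1) ^ S.card`. Both shifts are then eliminated by
`shift_corrIn`. -/
theorem sum_signs_dif_mul_corrIn {q : ℂ} (hq : q ≠ 0) {x : ℂ} {t : ι → ℂ}
    (h : Conv q t univ) {k : ℕ} (hk : 0 < k) :
    ∑ S : Finset ι, ∑ ε : S → ℤˣ,
        (-1 : ℂ) ^ (1 + S.card + negs ε) * (dif k (x * mon t ε) * corrIn q t k Sᶜ)
      = dif k (q * x) * corrIn q t k univ - (q * x) ^ (k : ℤ) * corr q t univ
        + ∑ S : Finset ι, ∑ ε : S → ℤˣ,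
          (-1 : ℂ) ^ (S.card + negs ε) * ((x * mon t ε) ^ (-(k : ℤ)) * corr q t Sᶜ) := by
  have h1 := shift_corrIn hq h hk (-1)
  have h2 := shift_corrIn hq h hk 0
  rw [neg_add_cancel, shift_zero, shift_zero] at h1
  rw [zero_add, shift_zero] at h2
  have sq : ∀ n : ℕ, ((-1 : ℂ) ^ n) * (-1) ^ n = 1 := fun n => by rw [← mul_pow]; simp
  have e1 : ∑ S : Finset ι, ∑ ε : S → ℤˣ,
        (-1 : ℂ) ^ (1 + S.card + negs ε) * (dif k (x * mon t ε) * corrIn q t k Sᶜ)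
      = -x ^ (k : ℤ) * shift k t (-1) (corrIn q t k) univ
        + x ^ (-(k : ℤ)) * shift k t 1 (corrIn q t k) univ := by
    rw [shift_univ, shift_univ, mul_sum, mul_sum, ← sum_add_distrib]
    refine sum_congr rfl fun S _ => ?_
    calc _ = -(-1) ^ S.card * corrIn q t k Sᶜ * (x ^ (k : ℤ) *
          (∑ ε : S → ℤˣ, (-1 : ℂ) ^ negs ε * mon t ε ^ (k : ℤ)) - x ^ (-(k : ℤ)) *
          ∑ ε : S → ℤˣ, (-1 : ℂ) ^ negs ε * mon t ε ^ (-(k : ℤ))) := by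
          rw [mul_sum, mul_sum, ← sum_sub_distrib, mul_sum]
          refine sum_congr rfl fun ε _ => ?_
          rw [dif, mul_zpow, mul_zpow, pow_add, pow_add]
          ring
      _ = _ := by
          rw [sum_signs_pow, sum_signs_inv_pow, one_pow]
          linear_combination (x ^ (-(k : ℤ)) * difs k t S * corrIn q t k Sᶜ) * sq S.card
  have e2 : ∑ S : Finset ι, ∑ ε : S → ℤˣ,
          (-1 : ℂ) ^ (S.card + negs ε) * ((x * mon t ε) ^ (-(k : ℤ)) * corr q t Sᶜ)
      = x ^ (-(k : ℤ)) * shift k t 1 (corr q t) univ := by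
    rw [shift_univ, mul_sum]
    refine sum_congr rfl fun S _ => ?_
    calc _ = (-1) ^ S.card * corr q t Sᶜ * x ^ (-(k : ℤ)) *
          ∑ ε : S → ℤˣ, (-1 : ℂ) ^ negs ε * mon t ε ^ (-(k : ℤ)) := by
          rw [mul_sum]
          refine sum_congr rfl fun ε _ => ?_
          rw [mul_zpow, pow_add]
          ring
      _ = _ := by
          rw [sum_signs_inv_pow, one_pow]
          linear_combination (x ^ (-(k : ℤ)) * difs k t S * corr q t Sᶜ) * sq S.card
  rw [e1, e2, h1]
  have hqk : q ^ k ≠ 0 := pow_ne_zero _ hq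
  have h3 : shift k t 1 (corr q t) univ = (q ^ k)⁻¹ * corrIn q t k univ
      + shift k t 1 (corrIn q t k) univ := by
    rw [h2]; field_simp; ring
  rw [h3, dif, mul_zpow, mul_zpow, zpow_natCast q, zpow_neg q, zpow_natCast q]
  ring

theorem corrCons_mul {q : ℂ} (hq : q ≠ 0) {x : ℂ} (hx : x ≠ 0) {t : ι → ℂ}
    (ht : ∀ i, t i ≠ 0) (h : ‖q‖ * (size (q * x) * ∏ i, size (t i)) < 1)
    (hred : ∀ (S : Finset ι) (ε : S → ℤˣ),
      ‖q‖ * (size (x * mon t ε) * ∏ i ∈ Sᶜ, size (t i)) < 1) :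
    corrCons q (q * x) t univ = ∑ S : Finset ι, ∑ ε : S → ℤˣ,
      (-1 : ℂ) ^ (1 + S.card + negs ε) * corrCons q (x * mon t ε) t Sᶜ := by
  have hq' := norm_pos_iff.2 hq
  have hx' := norm_pos_iff.2 hx
  have hM1 : 1 ≤ ∏ i, size (t i) := by
    simpa using prod_size_le (empty_subset univ) fun i _ => ht i
  have hM0 : 0 < ∏ i, size (t i) := zero_lt_one.trans_le hM1
  have hc : Conv q t univ := ⟨fun i _ => ht i, lt_of_le_of_lt (mul_le_mul_of_nonneg_left
    (le_mul_of_one_le_left hM0.le (one_le_size (mul_ne_zero hq hx))) hq'.le) h⟩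
  -- The term `S = ∅` gives `|q x| < 1`, and the left-hand side gives `|x| > ∏ size (t i)`, hence
  -- `|x * mon t ε| > 1`: these are the regions where the two geometric series converge.
  have hqx : ‖q * x‖ < 1 := by
    have h1 := hred ∅ (fun _ => 1)
    simp only [mon, univ_eq_empty, prod_empty, mul_one, compl_empty] at h1
    rw [norm_mul]
    refine lt_of_le_of_lt (mul_le_mul_of_nonneg_left ?_ hq'.le) h1
    exact (le_max_left _ _ : ‖x‖ ≤ size x).trans (le_mul_of_one_le_right (size_pos hx).le hM1)
  have hxM : ∏ i, size (t i) < ‖x‖ := by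
    have h1 : ‖q * x‖⁻¹ ≤ size (q * x) := le_max_right _ _
    have h2 : ‖q‖ * (‖q * x‖⁻¹ * ∏ i, size (t i)) < 1 :=
      lt_of_le_of_lt (mul_le_mul_of_nonneg_left (mul_le_mul_of_nonneg_right h1 hM0.le) hq'.le) h
    rw [norm_mul] at h2
    have h3 : ‖q‖ * ((‖q‖ * ‖x‖)⁻¹ * ∏ i, size (t i)) = (∏ i, size (t i)) / ‖x‖ := by
      field_simp
    rw [h3, div_lt_one hx'] at h2
    exact h2
  have hy : ∀ (S : Finset ι) (ε : S → ℤˣ), 1 < ‖x * mon t ε‖ := by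
    intro S ε
    have h1 := (norm_mon_le (fun i _ => ht i) ε).1
    have h2 : (∏ i, size (t i))⁻¹ ≤ ‖mon t ε‖ := by
      refine le_trans ((inv_le_inv₀ hM0 (prod_pos fun i _ => size_pos (ht i))).2 ?_) h1
      exact prod_size_le (subset_univ S) fun i _ => ht i
    rw [norm_mul]
    calc (1 : ℝ) = (∏ i, size (t i)) * (∏ i, size (t i))⁻¹ := (mul_inv_cancel₀ hM0.ne').symm
      _ < ‖x‖ * (∏ i, size (t i))⁻¹ := mul_lt_mul_of_pos_right hxM (inv_pos.2 hM0)
      _ ≤ _ := mul_le_mul_of_nonneg_left h2 hx'.le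
  have s1 := hasSum_sum (s := univ) fun (S : Finset ι) _ => hasSum_sum (s := univ)
    fun (ε : S → ℤˣ) _ => (hasSum_dif_mul_corrIn hq (mul_ne_zero hx (mon_ne_zero
      (fun i _ => ht i) ε)) (fun i _ => ht i) (hred S ε)).mul_left
        ((-1 : ℂ) ^ (1 + S.card + negs ε))
  have s2 := ((hasSum_dif_mul_corrIn hq (mul_ne_zero hq hx) (fun i _ => ht i) h).sub
    ((hasSum_pow_succ hqx).mul_right (corr q t univ))).add
      (hasSum_sum (s := univ) fun (S : Finset ι) _ => hasSum_sum (s := univ)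
        fun (ε : S → ℤˣ) _ => ((hasSum_inv_pow_succ (hy S ε)).mul_right (corr q t Sᶜ)).mul_left
          ((-1 : ℂ) ^ (S.card + negs ε)))
  have e := s1.unique (s2.congr_fun fun k =>
    sum_signs_dif_mul_corrIn hq hc (Nat.succ_pos k))
  have e3 : ∑ S : Finset ι, ∑ ε : S → ℤˣ, (-1 : ℂ) ^ (S.card + negs ε) * corr q t Sᶜ
      = corr q t univ := by
    have : ∀ S : Finset ι, ∑ ε : S → ℤˣ, (-1 : ℂ) ^ (S.card + negs ε) * corr q t Sᶜ
        = if S = ∅ then corr q t univ else 0 := by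
      intro S
      simp_rw [pow_add]
      rw [← sum_mul, ← mul_sum, sum_signs]
      split_ifs with hS
      · simp [hS]
      · simp
    rw [sum_congr rfl fun S _ => this S]
    simp
  have e4 : ∀ (S : Finset ι) (ε : S → ℤˣ),
      (-1 : ℂ) ^ (1 + S.card + negs ε) * (corrCons q (x * mon t ε) t Sᶜ
        - central (x * mon t ε) * corr q t Sᶜ)
      = (-1 : ℂ) ^ (1 + S.card + negs ε) * corrCons q (x * mon t ε) t Sᶜ
        + ((-1 : ℂ) ^ (S.card + negs ε) * ((central (x * mon t ε) - 1 / 2) * corr q t Sᶜ)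
        + 1 / 2 * ((-1 : ℂ) ^ (S.card + negs ε) * corr q t Sᶜ)) := by
    intro S ε
    rw [add_assoc, pow_add _ 1]
    ring
  simp only [e4, sum_add_distrib, ← mul_sum] at e
  rw [e3] at e
  linear_combination -e

end

section

/-! ### The kernels -/

/-- The series `∑_{j ≥ 1} (-1)^{j-1} j^s u^j`. -/
def altPowSeries (s : ℕ) (u : ℂ) : ℂ := ∑' j : ℕ, (-1 : ℂ) ^ j * ((j : ℂ) + 1) ^ s * u ^ (j + 1)

/-- The terms of the kernel. -/
def kerTerm (q : ℂ) (s j : ℕ) (y : ℂ) : ℂ :=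
  (-1) ^ j * ((j : ℂ) + 1) ^ s * (q ^ (j + 1) * y / (1 - q ^ (j + 1) * y))

/-- The kernel `∑_{j ≥ 1} (-1)^{j-1} j^s q^j y / (1 - q^j y)`, a meromorphic function of `y`. -/
def ker (q : ℂ) (s : ℕ) (y : ℂ) : ℂ := ∑' j : ℕ, kerTerm q s j y

theorem summable_altPow (s : ℕ) {u : ℂ} (hu : ‖u‖ < 1) :
    Summable fun j : ℕ => (-1 : ℂ) ^ j * ((j : ℂ) + 1) ^ s * u ^ (j + 1) := by
  have h := ((summable_nat_add_iff 1).2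
    (summable_pow_mul_geometric_of_norm_lt_one s (r := -u) (by simpa using hu))).neg
  refine h.congr fun j => ?_
  rw [neg_pow u]
  push_cast
  ring

theorem summable_succ_pow_mul_pow (s : ℕ) {r : ℝ} (h0 : 0 ≤ r) (h1 : r < 1) :
    Summable fun j : ℕ => ((j : ℝ) + 1) ^ s * r ^ (j + 1) := by
  have h := (summable_nat_add_iff 1).2
    (summable_pow_mul_geometric_of_norm_lt_one s (r := r) (by rwa [Real.norm_of_nonneg h0]))
  refine h.congr fun j => ?_
  push_cast
  rfl

theorem norm_coeff (s j : ℕ) : ‖(-1 : ℂ) ^ j * ((j : ℂ) + 1) ^ s‖ = ((j : ℝ) + 1) ^ s := by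
  have : ‖(j : ℂ) + 1‖ = (j : ℝ) + 1 := by
    rw [← Nat.cast_succ, Complex.norm_natCast, Nat.cast_succ]
  rw [norm_mul, norm_pow, norm_pow, norm_neg, norm_one, one_pow, one_mul, this]

/-- Expanding each kernel term as a geometric series in `q ^ (j + 1) * y` and exchanging the sums
over `j` and `k` gives the power series in `y`. -/
theorem hasSum_altPowSeries_mul_pow {q y : ℂ} (hq0 : q ≠ 0) (hq : ‖q‖ < 1) (hy : ‖q * y‖ < 1)
    (s : ℕ) :
    HasSum (fun k : ℕ => altPowSeries s (q ^ (k + 1)) * y ^ ((k + 1 : ℕ) : ℤ)) (ker q s y) := by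
  have hq' := norm_pos_iff.2 hq0
  have hle : ∀ j : ℕ, ‖q ^ (j + 1) * y‖ = ‖q‖ ^ j * ‖q * y‖ := fun j => by
    rw [norm_mul, norm_pow, norm_mul]; ring
  have hF : Summable fun p : ℕ × ℕ =>
      (-1 : ℂ) ^ p.1 * ((p.1 : ℂ) + 1) ^ s * (q ^ (p.1 + 1) * y) ^ (p.2 + 1) := by
    have h1 := (summable_succ_pow_mul_pow s hq'.le hq).mul_left ‖q‖⁻¹
    have h2 := (summable_nat_add_iff 1).2 (summable_geometric_of_lt_one (norm_nonneg _) hy)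
    refine Summable.of_norm_bounded (h1.mul_of_nonneg h2 (fun j => ?_) fun k => ?_) fun p => ?_
    · change 0 ≤ ‖q‖⁻¹ * (((j : ℝ) + 1) ^ s * ‖q‖ ^ (j + 1))
      positivity
    · exact pow_nonneg (norm_nonneg _) _
    · rw [norm_mul, norm_coeff, norm_pow, hle, mul_pow, pow_succ ‖q‖ p.1]
      -- Keeping a single factor `|q| ^ j` separates the two summation variables.
      have h3 : (‖q‖ ^ p.1) ^ (p.2 + 1) ≤ ‖q‖ ^ p.1 :=
        pow_le_of_le_one (by positivity) (pow_le_one₀ hq'.le hq.le) (Nat.succ_ne_zero _)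
      calc _ ≤ ((p.1 : ℝ) + 1) ^ s * (‖q‖ ^ p.1 * ‖q * y‖ ^ (p.2 + 1)) := by gcongr
        _ = _ := by field_simp
  have hj : HasSum (fun j => kerTerm q s j y)
      (∑' p : ℕ × ℕ, (-1 : ℂ) ^ p.1 * ((p.1 : ℂ) + 1) ^ s * (q ^ (p.1 + 1) * y) ^ (p.2 + 1)) := by
    refine hF.hasSum.prod_fiberwise fun j => ?_
    have hlt : ‖q ^ (j + 1) * y‖ < 1 := by
      rw [hle]
      exact lt_of_le_of_lt (mul_le_of_le_one_left (norm_nonneg _) (pow_le_one₀ hq'.le hq.le)) hy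
    have h := ((hasSum_geometric_of_norm_lt_one hlt).mul_left (q ^ (j + 1) * y)).mul_left
      ((-1 : ℂ) ^ j * ((j : ℂ) + 1) ^ s)
    rw [kerTerm, div_eq_mul_inv]
    exact h.congr_fun fun k => by rw [pow_succ']
  rw [ker, hj.tsum_eq]
  refine HasSum.prod_fiberwise ((Equiv.prodComm _ _).hasSum_iff.2 hF.hasSum) fun k => ?_
  have hlt : ‖q ^ (k + 1)‖ < 1 := by
    rw [norm_pow]; exact pow_lt_one₀ hq'.le hq (Nat.succ_ne_zero _)
  refine ((summable_altPow s hlt).hasSum.mul_right (y ^ ((k + 1 : ℕ) : ℤ))).congr_fun fun j => ?_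
  simp only [Function.comp_apply, Equiv.prodComm_apply, Prod.fst_swap, Prod.snd_swap]
  rw [zpow_natCast, mul_pow, ← pow_mul, ← pow_mul, mul_comm (j + 1) (k + 1)]
  ring

theorem norm_kerTerm_le {q y : ℂ} {ρ : ℝ} (s j : ℕ) (hy : ‖y‖ ≤ ρ)
    (h : ‖q‖ ^ (j + 1) * ρ ≤ 1 / 2) :
    ‖kerTerm q s j y‖ ≤ ((j : ℝ) + 1) ^ s * ‖q‖ ^ (j + 1) * (2 * ρ) := by
  have h1 : ‖q ^ (j + 1) * y‖ ≤ ‖q‖ ^ (j + 1) * ρ := by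
    rw [norm_mul, norm_pow]; gcongr
  have h2 : 1 / 2 ≤ ‖1 - q ^ (j + 1) * y‖ := by
    have := norm_sub_norm_le (1 : ℂ) (q ^ (j + 1) * y)
    rw [norm_one] at this
    linarith
  rw [kerTerm, norm_mul, norm_coeff, norm_div, mul_assoc]
  refine mul_le_mul_of_nonneg_left ?_ (by positivity)
  rw [div_le_iff₀ (by linarith)]
  have h3 : 0 ≤ ‖q‖ ^ (j + 1) * ρ := (norm_nonneg _).trans h1
  nlinarith

/-- On a ball around `0` containing `y` all but finitely many terms are free of poles and uniformly
dominated; the remaining ones are analytic at `y` by hypothesis. -/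
theorem analyticAt_ker {q : ℂ} (hq : ‖q‖ < 1) (s : ℕ) {y : ℂ}
    (hy : ∀ j : ℕ, q ^ (j + 1) * y ≠ 1) : AnalyticAt ℂ (ker q s) y := by
  set ρ : ℝ := ‖y‖ + 1
  have hρ : 0 < ρ := by positivity
  have hlim : Tendsto (fun j : ℕ => ‖q‖ ^ (j + 1) * ρ) atTop (𝓝 0) := by
    simpa using ((tendsto_pow_atTop_nhds_zero_of_lt_one (norm_nonneg q) hq).comp
      (tendsto_add_atTop_nat 1)).mul_const ρ
  obtain ⟨J, hJ⟩ := eventually_atTop.1 (hlim.eventually (ge_mem_nhds (by norm_num : (0 : ℝ) < 1 / 2)))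
  have hterm : ∀ (j : ℕ) (w : ℂ), q ^ (j + 1) * w ≠ 1 → AnalyticAt ℂ (kerTerm q s j) w := by
    intro j w hw
    unfold kerTerm
    exact analyticAt_const.mul ((analyticAt_const.mul analyticAt_id).div
      (analyticAt_const.sub (analyticAt_const.mul analyticAt_id)) (sub_ne_zero.2 hw.symm))
  have hu : Summable fun j : ℕ => ((j + J : ℕ) + 1 : ℝ) ^ s * ‖q‖ ^ (j + J + 1) * (2 * ρ) :=
    ((summable_nat_add_iff J).2 (summable_succ_pow_mul_pow s (norm_nonneg q) hq)).mul_right (2 * ρ)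
  have hbound : ∀ (j : ℕ) (w : ℂ), w ∈ Metric.ball (0 : ℂ) ρ → ‖kerTerm q s (j + J) w‖
      ≤ ((j + J : ℕ) + 1 : ℝ) ^ s * ‖q‖ ^ (j + J + 1) * (2 * ρ) := fun j w hw =>
    norm_kerTerm_le s (j + J) (mem_ball_zero_iff.1 hw).le (hJ _ (Nat.le_add_left _ _))
  have hne : ∀ (j : ℕ) (w : ℂ), w ∈ Metric.ball (0 : ℂ) ρ → q ^ (j + J + 1) * w ≠ 1 := by
    intro j w hw h
    have h1 : ‖q ^ (j + J + 1) * w‖ ≤ 1 / 2 := by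
      refine le_trans ?_ (hJ (j + J) (Nat.le_add_left _ _))
      rw [norm_mul, norm_pow]
      gcongr
      exact (mem_ball_zero_iff.1 hw).le
    rw [h, norm_one] at h1
    norm_num at h1
  have htail : AnalyticAt ℂ (fun w => ∑' j : ℕ, kerTerm q s (j + J) w) y := by
    have hd := Complex.differentiableOn_tsum_of_summable_norm hu
      (fun j w hw => (hterm (j + J) w (hne j w hw)).differentiableAt.differentiableWithinAt)
      Metric.isOpen_ball hbound
    exact hd.analyticAt (Metric.isOpen_ball.mem_nhds (mem_ball_zero_iff.2 (lt_add_one ‖y‖)))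
  have hfin : AnalyticAt ℂ (fun w => ∑ j ∈ range J, kerTerm q s j w) y :=
    Finset.analyticAt_fun_sum _ fun j _ => hterm j y (hy j)
  refine (hfin.add htail).congr ?_
  filter_upwards [Metric.isOpen_ball.mem_nhds
    (mem_ball_zero_iff.2 (lt_add_one ‖y‖) : y ∈ Metric.ball (0 : ℂ) ρ)] with w hw
  have hs : Summable fun j => kerTerm q s j w :=
    (summable_nat_add_iff J).1 (Summable.of_norm_bounded hu fun j => hbound j w hw)
  exact hs.sum_add_tsum_nat_add J

/-! ### Reduction of the number of variables -/

variable {ι : Type*} [DecidableEq ι]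

/-- Iterating `shift_corrIn` from `z = 0` gives an alternating sum of `shift j` of `corr`, with a
remainder `q ^ (k J)` times a polynomial in `J`, which tends to `0`. The powers `j ^ S.card` inside
`shift` produce `altPowSeries`. -/
theorem corrIn_eq {q : ℂ} (hq : q ≠ 0) (hq1 : ‖q‖ < 1) {t : ι → ℂ} {T : Finset ι}
    (h : Conv q t T) {k : ℕ} (hk : 0 < k) :
    corrIn q t k T = ∑ S ∈ T.powerset,
      altPowSeries S.card (q ^ k) * (difs k t S * corr q t (T \ S)) := by
  set u := q ^ k
  have hu : ‖u‖ < 1 := by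
    rw [norm_pow]; exact pow_lt_one₀ (norm_nonneg q) hq1 hk.ne'
  have h1 : HasSum (fun j : ℕ => (-1 : ℂ) ^ j * u ^ (j + 1) * shift k t (j + 1) (corr q t) T)
      (∑ S ∈ T.powerset, altPowSeries S.card u * (difs k t S * corr q t (T \ S))) := by
    refine (hasSum_sum fun S _ => (summable_altPow S.card hu).hasSum.mul_right
      (difs k t S * corr q t (T \ S))).congr_fun fun j => ?_
    rw [shift, mul_sum]
    exact sum_congr rfl fun S _ => by ring
  have h2 : ∀ J : ℕ, ∑ j ∈ range J, (-1 : ℂ) ^ j * u ^ (j + 1) * shift k t (j + 1) (corr q t) T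
      = corrIn q t k T - (-1) ^ J * u ^ J * shift k t J (corrIn q t k) T := by
    intro J
    induction J with
    | zero => simp [shift_zero]
    | succ J ih =>
      rw [sum_range_succ, ih, shift_corrIn hq h hk J]
      push_cast
      ring
  have h3 : Tendsto (fun J : ℕ => (-1 : ℂ) ^ J * u ^ J * shift k t J (corrIn q t k) T)
      atTop (𝓝 0) := by
    have h4 : ∀ S ∈ T.powerset, Tendsto (fun J : ℕ => (J : ℂ) ^ S.card * (-u) ^ J *
        (difs k t S * corrIn q t k (T \ S))) atTop (𝓝 0) := fun S _ => by
      simpa using (summable_pow_mul_geometric_of_norm_lt_one S.card (r := -u)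
        (by simpa using hu)).tendsto_atTop_zero.mul_const (difs k t S * corrIn q t k (T \ S))
    have h5 := tendsto_finsetSum _ h4
    rw [sum_const_zero] at h5
    refine h5.congr fun J => ?_
    rw [shift, mul_sum]
    exact sum_congr rfl fun S _ => by rw [neg_pow u]; ring
  have h6 := h1.tendsto_sum_nat
  simp_rw [h2] at h6
  have h7 := tendsto_nhds_unique h6 (h3.const_sub (corrIn q t k T))
  rw [h7, sub_zero]

/-- The coefficients in the reduction of the number of variables. -/
def kernelSum (q : ℂ) (x : ℂ) (t : ι → ℂ) (S : Finset ι) : ℂ :=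
  ∑ ε : S → ℤˣ, (-1 : ℂ) ^ negs ε *
    (ker q S.card (x * mon t ε) - ker q S.card (x⁻¹ * mon t ε))
  + if S = ∅ then central x else 0

theorem corrCons_eq [Fintype ι] {q : ℂ} (hq : q ≠ 0) (hq1 : ‖q‖ < 1) {x : ℂ} (hx : x ≠ 0)
    {t : ι → ℂ} (ht : ∀ i, t i ≠ 0) (h : ‖q‖ * (size x * ∏ i, size (t i)) < 1) :
    corrCons q x t univ = ∑ S : Finset ι, kernelSum q x t S * corr q t Sᶜ := by
  have hM0 : 0 < ∏ i, size (t i) := prod_pos fun i _ => size_pos (ht i)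
  have hc : Conv q t univ := ⟨fun i _ => ht i, lt_of_le_of_lt (mul_le_mul_of_nonneg_left
    (le_mul_of_one_le_left hM0.le (one_le_size hx)) (norm_nonneg q)) h⟩
  have hy : ∀ (z : ℂ) (S : Finset ι) (ε : S → ℤˣ), ‖z‖ ≤ size x → ‖q * (z * mon t ε)‖ < 1 := by
    intro z S ε hz
    refine lt_of_le_of_lt ?_ h
    rw [norm_mul, norm_mul]
    refine mul_le_mul_of_nonneg_left (mul_le_mul hz ?_ (norm_nonneg _) (size_pos hx).le)
      (norm_nonneg q)
    exact (norm_mon_le (fun i _ => ht i) ε).2.trans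
      (prod_size_le (subset_univ S) fun i _ => ht i)
  have h1 := hasSum_sum (s := univ) fun (S : Finset ι) _ =>
    (hasSum_sum (s := univ) fun (ε : S → ℤˣ) _ =>
      ((hasSum_altPowSeries_mul_pow hq hq1 (hy x S ε (le_max_left _ _)) S.card).sub
        (hasSum_altPowSeries_mul_pow hq hq1
          (hy x⁻¹ S ε ((norm_inv x).trans_le (le_max_right _ _))) S.card)).mul_left
            ((-1 : ℂ) ^ negs ε)).mul_right (corr q t Sᶜ)
  have h2 := hasSum_dif_mul_corrIn hq hx (fun i _ => ht i) h
  have h3 := h2.unique (h1.congr_fun fun k => by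
    rw [corrIn_eq hq hq1 hc k.succ_pos, powerset_univ, mul_sum]
    refine sum_congr rfl fun S _ => ?_
    rw [← compl_eq_univ_sdiff, ← sum_signs_pow, sum_mul, mul_sum, mul_sum, sum_mul]
    refine sum_congr rfl fun ε _ => ?_
    rw [dif, mul_zpow, mul_zpow, inv_zpow, zpow_neg]
    ring)
  have h4 : ∑ S : Finset ι, (if S = ∅ then central x else 0) * corr q t Sᶜ
      = central x * corr q t univ := by
    simp [ite_mul]
  simp only [kernelSum, add_mul, sum_add_distrib]
  rw [h4, ← h3]
  ring

end

/-! ### The correlation functions as traces -/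

theorem prod_orderEmbOfFin {M : Type*} [CommMonoid M] {n : ℕ} (S : Finset (Fin n))
    (f : Fin n → M) : ∏ j, f (S.orderEmbOfFin rfl j) = ∏ i ∈ S, f i := by
  conv_rhs => rw [← S.map_orderEmbOfFin_univ rfl]
  rw [prod_map]
  rfl

theorem R_eq_tsum (q : ℂ) {n : ℕ} (t : Fin n → ℂ) :
    R q n t = ∑' A : EvenIndex, q ^ (∑ a ∈ A.1, a) * ∏ i, eig A.1 (t i) :=
  tsum_congr fun A => diagEntry_nPointOp q t A

theorem R_orderEmbOfFin (q : ℂ) {n : ℕ} (t : Fin n → ℂ) (S : Finset (Fin n)) :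
    R q S.card (fun j => t (S.orderEmbOfFin rfl j)) = corr q t S := by
  rw [R_eq_tsum]
  exact tsum_congr fun A => by
    rw [prod_orderEmbOfFin S fun i => eig A.1 (t i)]; rfl

theorem R_cons (q y : ℂ) {n : ℕ} (t : Fin n → ℂ) :
    R q (n + 1) (Fin.cons y t) = corrCons q y t univ := by
  rw [R_eq_tsum]
  exact tsum_congr fun A => by simp [Fin.prod_univ_succ]

theorem R_reducedArgs (q x : ℂ) {n : ℕ} (t : Fin n → ℂ) (S : Finset (Fin n)) (ε : S → ℤˣ) :
    R q (Sᶜ.card + 1) (reducedArgs x t S ε) = corrCons q (x * mon t ε) t Sᶜ := by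
  rw [reducedArgs, R_cons]
  exact tsum_congr fun A => by
    rw [prod_orderEmbOfFin Sᶜ fun i => eig A.1 (t i)]; rfl

theorem mem_convDomain_cons {q y : ℂ} {n : ℕ} {t : Fin n → ℂ}
    (h : (Fin.cons y t : Fin (n + 1) → ℂ) ∈ convDomain q (n + 1)) :
    y ≠ 0 ∧ (∀ i, t i ≠ 0) ∧ ‖q‖ * (size y * ∏ i, size (t i)) < 1 := by
  refine ⟨by simpa using (h.1 0).1, fun i => by simpa using (h.1 i.succ).1, ?_⟩
  have := h.2
  rw [Fin.prod_univ_succ] at this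
  simpa [size] using this

theorem R_cons_mul {q : ℂ} (hq : q ≠ 0) {n : ℕ} (x : ℂ) (t : Fin n → ℂ)
    (h : (Fin.cons (q * x) t : Fin (n + 1) → ℂ) ∈ convDomain q (n + 1))
    (hred : ∀ (S : Finset (Fin n)) (ε : S → ℤˣ),
      reducedArgs x t S ε ∈ convDomain q (Sᶜ.card + 1)) :
    R q (n + 1) (Fin.cons (q * x) t) = ∑ S : Finset (Fin n), ∑ ε : S → ℤˣ,
      (-1 : ℂ) ^ (1 + S.card + (univ.filter fun i => ε i = -1).card) *
        R q (Sᶜ.card + 1) (reducedArgs x t S ε) := by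
  obtain ⟨h0, h1, h2⟩ := mem_convDomain_cons h
  simp only [R_cons, R_reducedArgs]
  refine corrCons_mul hq (right_ne_zero_of_mul h0) h1 h2 fun S ε => ?_
  have := (mem_convDomain_cons (hred S ε)).2.2
  rwa [prod_orderEmbOfFin Sᶜ fun i => size (t i)] at this

theorem conv_univ {q : ℂ} {n : ℕ} {t : Fin n → ℂ} (h : t ∈ convDomain q n) : Conv q t univ :=
  ⟨fun i _ => (h.1 i).1, h.2⟩

theorem summable_diagEntry {q : ℂ} (hq : q ≠ 0) {n : ℕ} {t : Fin n → ℂ}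
    (h : t ∈ convDomain q n) : Summable (diagEntry (nPointOp q t)) :=
  (summable_term hq (conv_univ h)).congr fun A => (diagEntry_nPointOp q t A).symm

/-! ### The two domains -/

theorem comp_mem_convDomain {q : ℂ} {m n : ℕ} {t : Fin n → ℂ} (h : t ∈ convDomain q n)
    (σ : Fin m ↪ Fin n) : t ∘ σ ∈ convDomain q m := by
  refine ⟨fun i => h.1 (σ i), ?_⟩
  have := ((conv_univ h).mono (subset_univ (univ.map σ))).2
  rwa [prod_map] at this

theorem comp_mem_regDomain {q : ℂ} {m n : ℕ} {t : Fin n → ℂ} (h : t ∈ regDomain q n)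
    (σ : Fin m ↪ Fin n) : t ∘ σ ∈ regDomain q m := by
  refine ⟨fun i => h.1 (σ i), fun e r hr => ?_⟩
  convert h.2 (Function.extend σ e 0) r hr using 1
  refine Fintype.prod_of_injective σ σ.injective _ _ (fun i hi => ?_) fun i => ?_
  · rw [Function.extend_apply' _ _ _ fun ⟨j, hj⟩ => hi ⟨j, hj⟩]; simp
  · rw [σ.injective.extend_apply]; rfl

theorem prod_zpow_sign_bounds {n : ℕ} {t : Fin n → ℂ} (ht : ∀ i, t i ≠ 0)
    (e : Fin n → SignType) :
    (∏ i, size (t i))⁻¹ ≤ ‖∏ i, t i ^ (e i : ℤ)‖ ∧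
      ‖∏ i, t i ^ (e i : ℤ)‖ ≤ ∏ i, size (t i) := by
  have h : ∀ i, (size (t i))⁻¹ ≤ ‖t i ^ (e i : ℤ)‖ ∧ ‖t i ^ (e i : ℤ)‖ ≤ size (t i) := by
    intro i
    rcases e i with _ | _ | _
    · simpa using And.intro (inv_le_one_of_one_le₀ (one_le_size (ht i))) (one_le_size (ht i))
    · simpa using size_inv_le_norm_zpow_unit (ht i) (-1)
    · simpa using size_inv_le_norm_zpow_unit (ht i) 1
  rw [norm_prod, ← prod_inv_distrib]
  exact ⟨prod_le_prod (fun i _ => inv_nonneg.2 (size_pos (ht i)).le) fun i _ => (h i).1,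
    prod_le_prod (fun i _ => norm_nonneg _) fun i _ => (h i).2⟩

/-- On `convDomain` the monomials have modulus strictly between `|q|` and `|q|⁻¹`, while `|q ^ r|`
with `r ≠ 0` lies outside that interval. -/
theorem convDomain_subset_regDomain {q : ℂ} (hq : q ≠ 0) (hq1 : ‖q‖ < 1) (n : ℕ) :
    convDomain q n ⊆ regDomain q n := by
  refine fun t h => ⟨h.1, fun e r hr heq => ?_⟩
  have hq' := norm_pos_iff.2 hq
  have ht : ∀ i, t i ≠ 0 := fun i => (h.1 i).1
  obtain ⟨h1, h2⟩ := prod_zpow_sign_bounds ht e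
  have h3 : ‖q‖ * ∏ i, size (t i) < 1 := h.2
  have hM : 0 < ∏ i, size (t i) := prod_pos fun i _ => size_pos (ht i)
  rw [heq, norm_zpow] at h1 h2
  rcases lt_or_gt_of_ne hr with hr | hr
  · have h4 : ‖q‖ ^ (-1 : ℤ) ≤ ‖q‖ ^ r :=
      zpow_le_zpow_right_of_le_one₀ hq' hq1.le (by omega)
    rw [zpow_neg_one] at h4
    have h5 : ‖q‖ * ‖q‖⁻¹ ≤ ‖q‖ * ∏ i, size (t i) :=
      mul_le_mul_of_nonneg_left (h4.trans h2) hq'.le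
    rw [mul_inv_cancel₀ hq'.ne'] at h5
    linarith
  · have h4 : ‖q‖ ^ r ≤ ‖q‖ ^ (1 : ℤ) := zpow_le_zpow_right_of_le_one₀ hq' hq1.le (by omega)
    rw [zpow_one] at h4
    have h5 : (∏ i, size (t i))⁻¹ * ∏ i, size (t i) ≤ ‖q‖ * ∏ i, size (t i) :=
      mul_le_mul_of_nonneg_right (h1.trans h4) hM.le
    rw [inv_mul_cancel₀ hM.ne'] at h5
    linarith

theorem isOpen_convDomain (q : ℂ) (n : ℕ) : IsOpen (convDomain q n) := by
  rw [isOpen_iff_mem_nhds]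
  intro t h
  have hc : ∀ i : Fin n, ContinuousAt (fun z : Fin n → ℂ => z i) t := fun i =>
    (continuous_apply i).continuousAt
  have h1 : ContinuousAt (fun z : Fin n → ℂ => ‖q‖ * ∏ i, max ‖z i‖ ‖z i‖⁻¹) t :=
    continuousAt_const.mul (tendsto_finsetProd _ fun i _ =>
      (hc i).norm.max ((hc i).norm.inv₀ (norm_ne_zero_iff.2 (h.1 i).1)))
  have h2 : ∀ᶠ z : Fin n → ℂ in 𝓝 t, ∀ i, z i ≠ 0 ∧ z i ≠ 1 := eventually_all.2 fun i =>
    ((hc i).eventually_ne (h.1 i).1).and ((hc i).eventually_ne (h.1 i).2)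
  exact h2.and (h1.eventually_lt continuousAt_const h.2)

/-! ### Connectedness -/

/-- Functions that are the exponential of an affine function along all exponential curves. -/
def IsMonomial {ι : Type*} (f : (ι → ℂ) → ℂ) : Prop :=
  ∀ α β : ι → ℂ, ∃ a b : ℂ, ∀ s : ℂ,
    f (fun i => Complex.exp (α i + s * β i)) = Complex.exp (a + s * b)

namespace IsMonomial

variable {ι : Type*} {f g : (ι → ℂ) → ℂ}

theorem coord (i : ι) : IsMonomial fun z : ι → ℂ => z i := fun α β => ⟨α i, β i, fun _ => rfl⟩

theorem const {c : ℂ} (hc : c ≠ 0) : IsMonomial fun _ : ι → ℂ => c := fun _ _ =>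
  ⟨Complex.log c, 0, fun _ => by rw [mul_zero, add_zero, Complex.exp_log hc]⟩

theorem mul (hf : IsMonomial f) (hg : IsMonomial g) : IsMonomial fun z => f z * g z := by
  intro α β
  obtain ⟨a, b, h⟩ := hf α β
  obtain ⟨c, d, h'⟩ := hg α β
  exact ⟨a + c, b + d, fun s => by beta_reduce; rw [h, h', ← Complex.exp_add]; ring_nf⟩

theorem zpow (hf : IsMonomial f) (m : ℤ) : IsMonomial fun z => f z ^ m := by
  intro α β
  obtain ⟨a, b, h⟩ := hf α β
  exact ⟨m * a, m * b, fun s => by beta_reduce; rw [h, ← Complex.exp_int_mul]; ring_nf⟩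

theorem prod {κ : Type*} (S : Finset κ) {f : κ → (ι → ℂ) → ℂ} (hf : ∀ k, IsMonomial (f k)) :
    IsMonomial fun z => ∏ k ∈ S, f k z := by
  classical
  induction S using Finset.induction_on with
  | empty => simpa using const (ι := ι) one_ne_zero
  | insert k S hk ih =>
    simp only [prod_insert hk]
    exact (hf k).mul ih

end IsMonomial

/-- Sets that contain all but countably many points of every exponential curve that starts
in them. -/
def IsCocountable {ι : Type*} (W : Set (ι → ℂ)) : Prop :=
  ∀ α β : ι → ℂ, (fun i => Complex.exp (α i)) ∈ W →
    {s : ℂ | (fun i => Complex.exp (α i + s * β i)) ∉ W}.Countable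

theorem countable_exp_eq (c : ℂ) : {w : ℂ | Complex.exp w = c}.Countable := by
  by_cases h : ∃ w, Complex.exp w = c
  · obtain ⟨w, rfl⟩ := h
    refine (Set.countable_range fun n : ℤ => w + n * (2 * Real.pi * Complex.I)).mono fun v hv => ?_
    obtain ⟨n, hn⟩ := Complex.exp_eq_exp_iff_exists_int.1 hv
    exact ⟨n, hn.symm⟩
  · exact Set.countable_empty.mono fun w hw => (h ⟨w, hw⟩).elim

theorem IsMonomial.isCocountable_ne {ι : Type*} {f : (ι → ℂ) → ℂ} (hf : IsMonomial f) (c : ℂ) :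
    IsCocountable {z | f z ≠ c} := by
  intro α β h0
  obtain ⟨a, b, h⟩ := hf α β
  have h1 : {s : ℂ | (fun i => Complex.exp (α i + s * β i)) ∉ {z | f z ≠ c}}
      = (fun s => a + s * b) ⁻¹' {w | Complex.exp w = c} := by
    ext s
    simp [h]
  rw [h1]
  -- If `b = 0`, the monomial is constant along the curve, and the starting point already avoids the
  -- value `c`.
  by_cases hb : b = 0
  · have h2 := h 0
    simp only [zero_mul, add_zero] at h2
    refine Set.countable_empty.mono fun s hs => h0 ?_
    rw [h2]
    simpa [hb] using hs
  · exact (countable_exp_eq c).preimage_of_injOn fun s _ s' _ hs =>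
      mul_right_cancel₀ hb (add_left_cancel hs)

theorem IsCocountable.iInter {ι κ : Type*} [Countable κ] {W : κ → Set (ι → ℂ)}
    (h : ∀ k, IsCocountable (W k)) : IsCocountable (⋂ k, W k) := by
  intro α β h0
  refine (Set.countable_iUnion fun k => h k α β (Set.mem_iInter.1 h0 k)).mono fun s hs => ?_
  simpa using hs

theorem IsCocountable.inter {ι : Type*} {V W : Set (ι → ℂ)} (hV : IsCocountable V)
    (hW : IsCocountable W) : IsCocountable (V ∩ W) := by
  rw [Set.inter_eq_iInter]
  exact iInter fun b => by cases b <;> assumption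

theorem isCocountable_preimage_regDomain (q : ℂ) {ι : Type*} {m : ℕ}
    {g : (ι → ℂ) → Fin m → ℂ} (hg : ∀ i, IsMonomial fun z => g z i) :
    IsCocountable (g ⁻¹' regDomain q m) := by
  have h : g ⁻¹' regDomain q m = (⋂ i, {z | g z i ≠ 0} ∩ {z | g z i ≠ 1}) ∩
      ⋂ (e : Fin m → SignType), ⋂ r : {r : ℤ // r ≠ 0},
        {z | ∏ i, g z i ^ (e i : ℤ) ≠ q ^ (r : ℤ)} := by
    ext z
    simp [regDomain]
  rw [h]
  exact (IsCocountable.iInter fun i => ((hg i).isCocountable_ne 0).inter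
    ((hg i).isCocountable_ne 1)).inter (.iInter fun e => .iInter fun r =>
      (IsMonomial.prod univ fun i => (hg i).zpow _).isCocountable_ne _)

/-- Logarithms of the coordinates give an exponential curve through any two points of `W`. Its
parameter runs over `ℂ`, of real dimension `2`, where the complement of a countable set is
path-connected. -/
theorem IsCocountable.isPreconnected {ι : Type*} {W : Set (ι → ℂ)} (h : IsCocountable W)
    (h0 : ∀ z ∈ W, ∀ i, z i ≠ 0) : IsPreconnected W := by
  refine isPreconnected_of_forall_pair fun a ha b hb => ?_
  let α : ι → ℂ := fun i => Complex.log (a i)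
  let β : ι → ℂ := fun i => Complex.log (b i) - Complex.log (a i)
  let γ : ℂ → ι → ℂ := fun s i => Complex.exp (α i + s * β i)
  have hγ : Continuous γ := continuous_pi fun i => by fun_prop
  have ha' : (fun i => Complex.exp (α i)) = a := funext fun i => Complex.exp_log (h0 a ha i)
  have hγ0 : γ 0 = a := by simp [γ, ha']
  have hγ1 : γ 1 = b := funext fun i => by simp [γ, α, β, Complex.exp_log (h0 b hb i)]
  have hcount := h α β (ha'.symm ▸ ha)
  have hconn : IsPathConnected {s : ℂ | γ s ∉ W}ᶜ :=
    hcount.isPathConnected_compl_of_one_lt_rank (by simp [Complex.rank_real_complex])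
  refine ⟨γ '' {s : ℂ | γ s ∉ W}ᶜ, ?_, ⟨0, ?_, hγ0⟩, ⟨1, ?_, hγ1⟩,
    hconn.isConnected.isPreconnected.image γ hγ.continuousOn⟩
  · rintro _ ⟨s, hs, rfl⟩
    exact not_not.1 hs
  · simpa [hγ0] using ha
  · simpa [hγ1] using hb

theorem isPreconnected_regDomain (q : ℂ) (n : ℕ) : IsPreconnected (regDomain q n) :=
  IsCocountable.isPreconnected (isCocountable_preimage_regDomain q (g := id) IsMonomial.coord)
    fun _ hz i => (hz.1 i).1

/-! ### Analytic continuation -/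

/-- The kernel arguments are monomials with exponents in `{-1, 0, 1}`, so the poles of the kernels
lie on hypersurfaces excluded from `regDomain`. -/
theorem exists_sign_prod {n : ℕ} (t : Fin (n + 1) → ℂ) (e₀ : SignType) {S : Finset (Fin n)}
    (ε : S → ℤˣ) : ∃ e : Fin (n + 1) → SignType,
      ∏ i, t i ^ (e i : ℤ) = t 0 ^ (e₀ : ℤ) * mon (Fin.tail t) ε := by
  let e : Fin n → SignType :=
    Function.extend ((↑) : S → Fin n) (fun i => if ε i = 1 then 1 else -1) 0
  refine ⟨Fin.cons e₀ e, ?_⟩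
  rw [Fin.prod_univ_succ]
  simp only [Fin.cons_zero, Fin.cons_succ]
  congr 1
  refine (Fintype.prod_of_injective _ Subtype.val_injective _ _ (fun i hi => ?_) fun i => ?_).symm
  · simp only [e]
    rw [Function.extend_apply' _ _ _ fun ⟨j, hj⟩ => hi ⟨j, hj⟩]
    simp
  · simp only [e]
    rw [Subtype.val_injective.extend_apply]
    rcases Int.units_eq_one_or (ε i) with h | h
    · simp [h, Fin.tail]
    · simp [h, Fin.tail]

theorem pow_mul_ne_one {q : ℂ} {n : ℕ} {t : Fin (n + 1) → ℂ}
    (h : t ∈ regDomain q (n + 1)) (e₀ : SignType) {S : Finset (Fin n)} (ε : S → ℤˣ) (j : ℕ) :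
    q ^ (j + 1) * (t 0 ^ (e₀ : ℤ) * mon (Fin.tail t) ε) ≠ 1 := by
  obtain ⟨e, he⟩ := exists_sign_prod t e₀ ε
  intro h1
  refine h.2 e (-((j + 1 : ℕ) : ℤ)) (by omega) ?_
  rw [he, zpow_neg, zpow_natCast]
  exact eq_inv_of_mul_eq_one_right h1

theorem analyticAt_coord {n : ℕ} (i : Fin n) (t : Fin n → ℂ) :
    AnalyticAt ℂ (fun z : Fin n → ℂ => z i) t :=
  (ContinuousLinearMap.proj (R := ℂ) (φ := fun _ : Fin n => ℂ) i).analyticAt t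

theorem analyticAt_mon_tail {n : ℕ} {t : Fin (n + 1) → ℂ} (ht : ∀ i, t i ≠ 0)
    {S : Finset (Fin n)} (ε : S → ℤˣ) :
    AnalyticAt ℂ (fun z : Fin (n + 1) → ℂ => mon (Fin.tail z) ε) t :=
  Finset.analyticAt_fun_prod _ fun _ _ => (analyticAt_coord _ t).zpow (ht _)

theorem analyticAt_kernelSum {q : ℂ} (hq1 : ‖q‖ < 1) {n : ℕ} {t : Fin (n + 1) → ℂ}
    (h : t ∈ regDomain q (n + 1)) (S : Finset (Fin n)) :
    AnalyticAt ℂ (fun z : Fin (n + 1) → ℂ => kernelSum q (z 0) (Fin.tail z) S) t := by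
  have ht : ∀ i, t i ≠ 0 := fun i => (h.1 i).1
  have h0 := analyticAt_coord 0 t
  have hm := fun ε : S → ℤˣ => analyticAt_mon_tail ht ε
  refine AnalyticAt.add (Finset.analyticAt_fun_sum _ fun ε _ => analyticAt_const.mul
    (AnalyticAt.sub ?_ ?_)) ?_
  · refine AnalyticAt.comp (g := ker q S.card) (f := fun z : Fin (n + 1) → ℂ =>
      z 0 * mon (Fin.tail z) ε) (analyticAt_ker hq1 _ fun j => ?_) (h0.mul (hm ε))
    simpa using pow_mul_ne_one h 1 ε j
  · refine AnalyticAt.comp (g := ker q S.card) (f := fun z : Fin (n + 1) → ℂ =>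
      (z 0)⁻¹ * mon (Fin.tail z) ε) (analyticAt_ker hq1 _ fun j => ?_) ((h0.inv (ht 0)).mul (hm ε))
    simpa using pow_mul_ne_one h (-1) ε j
  · split_ifs
    · exact (h0.add analyticAt_const).div (analyticAt_const.mul (h0.sub analyticAt_const))
        (mul_ne_zero two_ne_zero (sub_ne_zero.2 (h.1 0).2))
    · exact analyticAt_const

/-- `F` continues the `n`-point function analytically to the regular domain. -/
def IsContinuation (q : ℂ) (n : ℕ) (F : (Fin n → ℂ) → ℂ) : Prop :=
  AnalyticOnNhd ℂ F (regDomain q n) ∧ Set.EqOn F (R q n) (convDomain q n)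

/-- The recursion `corrCons_eq` serves as the definition of the continuation, since its coefficients
are analytic on all of `regDomain`. -/
theorem exists_isContinuation {q : ℂ} (hq : q ≠ 0) (hq1 : ‖q‖ < 1) (n : ℕ) :
    ∃ F, IsContinuation q n F := by
  induction n using Nat.strong_induction_on with
  | _ n ih =>
    rcases n with _ | n
    · exact ⟨fun _ => R q 0 finZeroElim, fun _ _ => analyticAt_const, fun t _ =>
        congrArg (R q 0) (Subsingleton.elim _ _)⟩
    choose G hG using ih
    have hlt : ∀ S : Finset (Fin n), Sᶜ.card < n + 1 := fun S =>
      Nat.lt_succ_of_le ((card_le_univ _).trans_eq (Fintype.card_fin n))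
    let σ : ∀ S : Finset (Fin n), Fin Sᶜ.card ↪ Fin (n + 1) := fun S =>
      (Sᶜ.orderEmbOfFin rfl).toEmbedding.trans (Fin.succEmb n)
    refine ⟨fun t => ∑ S : Finset (Fin n), kernelSum q (t 0) (Fin.tail t) S *
      G _ (hlt S) (t ∘ σ S), fun t ht => ?_, fun t ht => ?_⟩
    · refine Finset.analyticAt_fun_sum _ fun S _ => (analyticAt_kernelSum hq1 ht S).mul ?_
      exact AnalyticAt.comp (g := G _ (hlt S)) (f := fun z : Fin (n + 1) → ℂ => z ∘ σ S)
        ((hG _ (hlt S)).1 _ (comp_mem_regDomain ht (σ S)))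
        (analyticAt_pi_iff.2 fun i => analyticAt_coord _ t)
    · have hcons : (Fin.cons (t 0) (Fin.tail t) : Fin (n + 1) → ℂ) = t := Fin.cons_self_tail t
      obtain ⟨h0, h1, h2⟩ := mem_convDomain_cons (hcons.symm ▸ ht)
      rw [← hcons, R_cons, corrCons_eq hq hq1 h0 h1 h2, hcons]
      refine sum_congr rfl fun S _ => ?_
      rw [(hG _ (hlt S)).2 (comp_mem_convDomain ht (σ S)), ← R_orderEmbOfFin]
      rfl

theorem neg_one_mem_convDomain {q : ℂ} (hq1 : ‖q‖ < 1) (n : ℕ) :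
    (fun _ => -1 : Fin n → ℂ) ∈ convDomain q n := by
  refine ⟨fun _ => ⟨by norm_num, by norm_num⟩, by simpa using hq1⟩

theorem IsContinuation.eqOn {q : ℂ} (hq : q ≠ 0) (hq1 : ‖q‖ < 1) {n : ℕ}
    {F G : (Fin n → ℂ) → ℂ} (hF : IsContinuation q n F) (hG : IsContinuation q n G) :
    Set.EqOn G F (regDomain q n) := by
  have h := neg_one_mem_convDomain hq1 n
  refine hG.1.eqOn_of_preconnected_of_eventuallyEq hF.1 (isPreconnected_regDomain q n)
    (convDomain_subset_regDomain hq hq1 n h) ?_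
  filter_upwards [(isOpen_convDomain q n).mem_nhds h] with t ht
  rw [hG.2 ht, hF.2 ht]

/-! ### The difference equation for the continued functions -/

/-- The arguments on the left-hand side of the difference equation. -/
def scaledArgs (q : ℂ) {n : ℕ} (z : Fin (n + 1) → ℂ) : Fin (n + 1) → ℂ :=
  Fin.cons (q * z 0) (Fin.tail z)

theorem analyticAt_scaledArgs (q : ℂ) {n : ℕ} (z : Fin (n + 1) → ℂ) :
    AnalyticAt ℂ (scaledArgs q : (Fin (n + 1) → ℂ) → Fin (n + 1) → ℂ) z := by
  refine analyticAt_pi_iff.2 fun i => ?_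
  refine Fin.cases ?_ (fun i => ?_) i
  · exact analyticAt_const.mul (analyticAt_coord 0 z)
  · exact analyticAt_coord i.succ z

theorem analyticAt_reducedArgs {n : ℕ} {z : Fin (n + 1) → ℂ} (hz : ∀ i, z i ≠ 0)
    (S : Finset (Fin n)) (ε : S → ℤˣ) :
    AnalyticAt ℂ (fun z : Fin (n + 1) → ℂ => reducedArgs (z 0) (Fin.tail z) S ε) z := by
  refine analyticAt_pi_iff.2 fun i => ?_
  refine Fin.cases ?_ (fun i => ?_) i
  · exact (analyticAt_coord 0 z).mul (analyticAt_mon_tail hz ε)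
  · exact analyticAt_coord _ z

/-- The points where all the terms of the difference equation lie in the regular domains. -/
def equationDomain (q : ℂ) (n : ℕ) : Set (Fin (n + 1) → ℂ) :=
  scaledArgs q ⁻¹' regDomain q (n + 1) ∩
    ⋂ (S : Finset (Fin n)), ⋂ (ε : S → ℤˣ),
      (fun z => reducedArgs (z 0) (Fin.tail z) S ε) ⁻¹' regDomain q (Sᶜ.card + 1)

theorem ne_zero_of_mem_equationDomain {q : ℂ} {n : ℕ} {z : Fin (n + 1) → ℂ}
    (hz : z ∈ equationDomain q n) (i : Fin (n + 1)) : z i ≠ 0 := by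
  refine Fin.cases ?_ (fun i => ?_) i
  · exact right_ne_zero_of_mul (hz.1.1 0).1
  · exact (hz.1.1 i.succ).1

theorem isPreconnected_equationDomain {q : ℂ} (hq : q ≠ 0) (n : ℕ) :
    IsPreconnected (equationDomain q n) := by
  refine IsCocountable.isPreconnected (.inter (isCocountable_preimage_regDomain q fun i => ?_)
    (.iInter fun S => .iInter fun ε => isCocountable_preimage_regDomain q fun i => ?_))
    fun z hz => ne_zero_of_mem_equationDomain hz
  · refine Fin.cases ?_ (fun i => ?_) i
    · exact (IsMonomial.const hq).mul (IsMonomial.coord 0)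
    · exact IsMonomial.coord i.succ
  · refine Fin.cases ?_ (fun i => ?_) i
    · exact (IsMonomial.coord 0).mul (IsMonomial.prod univ fun i => (IsMonomial.coord _).zpow _)
    · exact IsMonomial.coord _

theorem exists_mem_convDomain {q : ℂ} (hq : q ≠ 0) (hq1 : ‖q‖ < 1) (n : ℕ) :
    ∃ z : Fin (n + 1) → ℂ, scaledArgs q z ∈ convDomain q (n + 1) ∧
      ∀ (S : Finset (Fin n)) (ε : S → ℤˣ),
        reducedArgs (z 0) (Fin.tail z) S ε ∈ convDomain q (Sᶜ.card + 1) := by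
  have hq' := norm_pos_iff.2 hq
  -- The point is `(r, -1, …, -1)` with `1 < r < |q|⁻¹`: entries `-1` have size `1`, so the
  -- conditions reduce to `r⁻¹ < 1` for the left-hand side and `|q| * r < 1` for the reduced
  -- arguments.
  obtain ⟨r, hr1, hr2⟩ := exists_between ((one_lt_inv₀ hq').2 hq1)
  have hr0 : 0 < r := zero_lt_one.trans hr1
  have hqr : ‖q‖ * r < 1 := by
    have := mul_lt_mul_of_pos_left hr2 hq'
    rwa [mul_inv_cancel₀ hq'.ne'] at this
  have hnr : ‖(r : ℂ)‖ = r := by rw [Complex.norm_real, Real.norm_of_nonneg hr0.le]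
  have hr0' : (r : ℂ) ≠ 0 := by exact_mod_cast hr0.ne'
  have hcons : ∀ (m : ℕ) (y : ℂ), y ≠ 0 → y ≠ 1 → ‖q‖ * max ‖y‖ ‖y‖⁻¹ < 1 →
      (Fin.cons y (fun _ => -1) : Fin (m + 1) → ℂ) ∈ convDomain q (m + 1) := by
    intro m y h0 h1 h2
    refine ⟨fun i => ?_, ?_⟩
    · refine Fin.cases ⟨h0, h1⟩ (fun i => ?_) i
      simp only [Fin.cons_succ]
      exact ⟨by norm_num, by norm_num⟩
    · rw [Fin.prod_univ_succ]
      simpa using h2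
  refine ⟨Fin.cons (r : ℂ) fun _ => -1, hcons n _ (mul_ne_zero hq hr0') ?_ ?_, fun S ε =>
    hcons _ _ (mul_ne_zero hr0' (mon_ne_zero (fun _ _ => ?_) ε)) ?_ ?_⟩
  · intro h
    have h1 : ‖q * (r : ℂ)‖ = 1 := by rw [show q * (r : ℂ) = 1 from h, norm_one]
    rw [norm_mul, hnr] at h1
    linarith
  · change ‖q‖ * max ‖q * (r : ℂ)‖ ‖q * (r : ℂ)‖⁻¹ < 1
    rw [norm_mul, hnr, mul_max_of_nonneg _ _ hq'.le, max_lt_iff]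
    refine ⟨by nlinarith, ?_⟩
    have : ‖q‖ * (‖q‖ * r)⁻¹ = r⁻¹ := by field_simp
    rw [this]
    exact inv_lt_one_of_one_lt₀ hr1
  · change (-1 : ℂ) ≠ 0
    norm_num
  all_goals
    have hm : ‖(r : ℂ) * mon (fun _ : Fin n => (-1 : ℂ)) ε‖ = r := by
      rw [norm_mul, hnr, mon, norm_prod, prod_eq_one, mul_one]
      intro i _
      rw [norm_zpow, norm_neg, norm_one, one_zpow]
  · intro h
    have h' : (r : ℂ) * mon (fun _ : Fin n => (-1 : ℂ)) ε = 1 := h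
    rw [h', norm_one] at hm
    linarith
  · change ‖q‖ * max ‖(r : ℂ) * mon (fun _ : Fin n => (-1 : ℂ)) ε‖
      ‖(r : ℂ) * mon (fun _ : Fin n => (-1 : ℂ)) ε‖⁻¹ < 1
    rw [hm, max_eq_left ((inv_lt_one_of_one_lt₀ hr1).le.trans hr1.le)]
    exact hqr

/-- Both sides are analytic on the connected `equationDomain` and agree near a point where every
term is a convergent trace. -/
theorem continuation_cons_mul {q : ℂ} (hq : q ≠ 0) (hq1 : ‖q‖ < 1)
    {F : (n : ℕ) → (Fin n → ℂ) → ℂ} (hF : ∀ n, IsContinuation q n (F n)) {n : ℕ}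
    {z : Fin (n + 1) → ℂ} (hz : z ∈ equationDomain q n) :
    F (n + 1) (scaledArgs q z) = ∑ S : Finset (Fin n), ∑ ε : S → ℤˣ,
      (-1 : ℂ) ^ (1 + S.card + (univ.filter fun i => ε i = -1).card) *
        F (Sᶜ.card + 1) (reducedArgs (z 0) (Fin.tail z) S ε) := by
  obtain ⟨w, hw, hw'⟩ := exists_mem_convDomain hq hq1 n
  have hwE : w ∈ equationDomain q n := ⟨convDomain_subset_regDomain hq hq1 _ hw,
    Set.mem_iInter₂.2 fun S ε => convDomain_subset_regDomain hq hq1 _ (hw' S ε)⟩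
  refine AnalyticOnNhd.eqOn_of_preconnected_of_eventuallyEq (𝕜 := ℂ)
    (f := fun z => F (n + 1) (scaledArgs q z))
    (g := fun z => ∑ S : Finset (Fin n), ∑ ε : S → ℤˣ,
      (-1 : ℂ) ^ (1 + S.card + (univ.filter fun i => ε i = -1).card) *
        F (Sᶜ.card + 1) (reducedArgs (z 0) (Fin.tail z) S ε))
    (fun v hv => ?_) (fun v hv => ?_) (isPreconnected_equationDomain hq n) hwE ?_ hz
  · exact AnalyticAt.comp (g := F (n + 1)) ((hF _).1 _ hv.1) (analyticAt_scaledArgs q v)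
  · exact Finset.analyticAt_fun_sum _ fun S _ => Finset.analyticAt_fun_sum _ fun ε _ =>
      analyticAt_const.mul (AnalyticAt.comp (g := F (Sᶜ.card + 1))
        ((hF _).1 _ (Set.mem_iInter₂.1 hv.2 S ε))
        (analyticAt_reducedArgs (ne_zero_of_mem_equationDomain hv) S ε))
  · have h1 : ∀ᶠ v in 𝓝 w, scaledArgs q v ∈ convDomain q (n + 1) :=
      (analyticAt_scaledArgs q w).continuousAt.eventually_mem
        ((isOpen_convDomain q _).mem_nhds hw)
    have h2 : ∀ᶠ v : Fin (n + 1) → ℂ in 𝓝 w, ∀ (S : Finset (Fin n)) (ε : S → ℤˣ),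
        reducedArgs (v 0) (Fin.tail v) S ε ∈ convDomain q (Sᶜ.card + 1) :=
      eventually_all.2 fun S => eventually_all.2 fun ε =>
        (analyticAt_reducedArgs (ne_zero_of_mem_equationDomain hwE) S ε).continuousAt.eventually_mem
          ((isOpen_convDomain q _).mem_nhds (hw' S ε))
    filter_upwards [h1, h2] with v hv1 hv2
    rw [(hF _).2 hv1, scaledArgs, R_cons_mul hq _ _ hv1 hv2]
    exact sum_congr rfl fun S _ => sum_congr rfl fun ε _ => by rw [(hF _).2 (hv2 S ε)]

end TwistedFock

end

theorem mainTheorem3 (q : ℂ) (hq0 : q ≠ 0) (hq1 : ‖q‖ < 1) :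
    -- the trace defining `R` converges absolutely
    (∀ (n : ℕ) (t : Fin n → ℂ), t ∈ TwistedFock.convDomain q n →
      Summable (TwistedFock.diagEntry (TwistedFock.nPointOp q t))) ∧
    -- the difference equation between convergent traces
    (∀ (n : ℕ) (x : ℂ) (t : Fin n → ℂ),
      (Fin.cons (q * x) t : Fin (n + 1) → ℂ) ∈ TwistedFock.convDomain q (n + 1) →
      (∀ (S : Finset (Fin n)) (ε : S → ℤˣ),
        TwistedFock.reducedArgs x t S ε ∈ TwistedFock.convDomain q (Sᶜ.card + 1)) →
      TwistedFock.R q (n + 1) (Fin.cons (q * x) t) =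
        ∑ S : Finset (Fin n), ∑ ε : S → ℤˣ,
          (-1 : ℂ) ^ (1 + S.card + (Finset.univ.filter fun i => ε i = -1).card) *
            TwistedFock.R q (Sᶜ.card + 1) (TwistedFock.reducedArgs x t S ε)) ∧
    -- `R` has a unique analytic continuation, and it satisfies the difference equation
    (∃ F : (n : ℕ) → (Fin n → ℂ) → ℂ,
      (∀ n, AnalyticOnNhd ℂ (F n) (TwistedFock.regDomain q n) ∧
        Set.EqOn (F n) (TwistedFock.R q n) (TwistedFock.convDomain q n)) ∧
      (∀ (n : ℕ) (G : (Fin n → ℂ) → ℂ), AnalyticOnNhd ℂ G (TwistedFock.regDomain q n) →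
        Set.EqOn G (TwistedFock.R q n) (TwistedFock.convDomain q n) →
        Set.EqOn G (F n) (TwistedFock.regDomain q n)) ∧
      (∀ (n : ℕ) (x : ℂ) (t : Fin n → ℂ),
        (Fin.cons (q * x) t : Fin (n + 1) → ℂ) ∈ TwistedFock.regDomain q (n + 1) →
        (∀ (S : Finset (Fin n)) (ε : S → ℤˣ),
          TwistedFock.reducedArgs x t S ε ∈ TwistedFock.regDomain q (Sᶜ.card + 1)) →
        F (n + 1) (Fin.cons (q * x) t) =
          ∑ S : Finset (Fin n), ∑ ε : S → ℤˣ,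
            (-1 : ℂ) ^ (1 + S.card + (Finset.univ.filter fun i => ε i = -1).card) *
              F (Sᶜ.card + 1) (TwistedFock.reducedArgs x t S ε))) := by
  choose F hF using fun n => TwistedFock.exists_isContinuation hq0 hq1 n
  refine ⟨fun n t ht => TwistedFock.summable_diagEntry hq0 ht,
    fun n x t h hred => TwistedFock.R_cons_mul hq0 x t h hred, F, hF,
    fun n G hG hGR => (hF n).eqOn hq0 hq1 ⟨hG, hGR⟩, fun n x t h hred => ?_⟩
  exact TwistedFock.continuation_cons_mul hq0 hq1 hF (z := Fin.cons x t)
    ⟨h, Set.mem_iInter₂.2 hred⟩
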